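/- For a permutation $w$ write $l(w)$ for its number of inversions, $t_{ij}$ for the transposition of $i,j$, $s_i=t_{i,i+1}$, and $(wt_{ij})(k)=w(t_{ij}(k))$. Let $S_\infty=\bigcup_n S_n$. Grothendieck polynomials. For $w\in S_n$ the polynomial $\mathfrak G_w\in\mathbb Z[x_1,x_2,\ldots]$ is defined by $\mathfrak G_{w}=x_1^{n-1}x_2^{n-2}\cdots x_{n-1}$ if $w$ is the longest element of $S_n$, and $\mathfrak G_w=\partial_i\big((1-x_{i+1})\,\mathfrak G_{ws_i}\big)$ whenever $w(i)<w(i+1)$, $1\le i<n$, where $\partial_i f=(f-s_if)/(x_i-x_{i+1})$ and $s_i f$ is $f$ with $x_i,x_{i+1}$ interchanged. It depends neither on the choices of $i$ nor on $n$; thus $\mathfrak G_w$ is defined for $w\in S_\infty$. Quadratic algebra. $\mathcal E_n$ is the associative unital $\mathbb Z$-algebra with generators $[ij]$, $1\le i\ne j\le n$, and relations $[ij]+[ji]=0$, $[ij]^2=0$, $[ij][jk]+[jk][ki]+[ki][ij]=0$, $[ij][kl]=[kl][ij]$ for all distinct $i,j,k,l$. For $1\le p\le n$ put $$\kappa_p=1-(1+[p-1,p])(1+[p-2,p])\cdots(1+[1,p])(1+[n,p])(1+[n-1,p])\cdots(1+[p+1,p])\in\mathcal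 E_n.$$ The $\kappa_p$ commute pairwise, so that $\mathfrak G_u(\kappa):=\mathfrak G_u(\kappa_1,\ldots,\kappa_{n-1})$ is defined for $u\in S_n$ (only $x_1,\ldots,x_{n-1}$ occur in $\mathfrak G_u$). Bruhat representation. $\mathcal E_n$ acts on the free abelian group $\mathbb Z\langle S_n\rangle$ with basis $S_n$ by: for $i<j$, $[ij]\,w=wt_{ij}$ if $l(wt_{ij})=l(w)+1$, and $[ij]\,w=0$ otherwise. The factors of a product act from left to right, i.e. $(ab)\,w=b\,(a\,w)$. Corollary. Let $n\ge 0$ and $u,v\in S_n$. There is exactly one family of integers $(c_{uv}^w)_{w\in S_\infty}$, almost all zero, with $$\mathfrak G_u\,\mathfrak G_v=\sum_{w\in S_\infty}c_{uv}^w\,\mathfrak G_w,$$ and for every $w\in S_n$ with $l(w)\ge l(u)+l(v)$ the structure constant $c_{uv}^w$ is equal to the coefficient of $w$ in $\mathfrak G_u(\kappa)\,v$. -/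

import Mathlib

namespace KFlag

open MvPolynomial

/-! ### Permutations -/

/-- The length `l(w)` of `w ∈ S_n`: the number of inversions. Positions are `0, …, n-1`. -/
def length {n : ℕ} (w : Equiv.Perm (Fin n)) : ℕ :=
  (Finset.univ.filter fun p : Fin n × Fin n => p.1 < p.2 ∧ w p.2 < w p.1).card

/-- `S_∞`, the union of all `S_n`: permutations of `ℕ` fixing all sufficiently large numbers. -/
abbrev SInf : Type := {w : Equiv.Perm ℕ // ∃ N : ℕ, ∀ i, N ≤ i → w i = i}

/-- The usual inclusion `S_n ↪ S_∞`. -/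
noncomputable def toSInf {n : ℕ} (w : Equiv.Perm (Fin n)) : SInf :=
  ⟨w.extendDomain Fin.equivSubtype, n, fun _ hi =>
    Equiv.Perm.extendDomain_apply_not_subtype _ _ (not_lt.mpr hi)⟩

/-! ### Grothendieck polynomials

The variable `x_{i+1}` of the usual notation is `X i`. -/

theorem sub_swap_dvd (i : ℕ) (f : MvPolynomial ℕ ℤ) :
    (X i - X (i + 1) : MvPolynomial ℕ ℤ) ∣ f - rename (Equiv.swap i (i + 1)) f := by
  induction f using MvPolynomial.induction_on with
  | C a => simp
  | add p q hp hq =>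
    have : p + q - rename (Equiv.swap i (i + 1)) (p + q)
        = (p - rename (Equiv.swap i (i + 1)) p) + (q - rename (Equiv.swap i (i + 1)) q) := by
      rw [map_add]; ring
    rw [this]
    exact dvd_add hp hq
  | mul_X p j hp =>
    have : p * X j - rename (Equiv.swap i (i + 1)) (p * X j)
        = (p - rename (Equiv.swap i (i + 1)) p) * X j
          + rename (Equiv.swap i (i + 1)) p * (X j - X (Equiv.swap i (i + 1) j)) := by
      rw [map_mul, rename_X]; ring
    rw [this]
    refine dvd_add (dvd_mul_of_dvd_left hp _) (dvd_mul_of_dvd_right ?_ _)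
    by_cases h1 : j = i
    · subst h1; simp
    · by_cases h2 : j = i + 1
      · subst h2
        rw [Equiv.swap_apply_right]
        exact (dvd_sub_comm).mp dvd_rfl
      · rw [Equiv.swap_apply_of_ne_of_ne h1 h2]; simp

/-- The divided difference `(f - s_i f) / (x_i - x_{i+1})`: the unique polynomial `q` with
`f - s_i f = (x_i - x_{i+1}) q`. -/
noncomputable def divDiff (i : ℕ) (f : MvPolynomial ℕ ℤ) : MvPolynomial ℕ ℤ :=
  (sub_swap_dvd i f).choose

theorem divDiff_spec (i : ℕ) (f : MvPolynomial ℕ ℤ) :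
    f - rename (Equiv.swap i (i + 1)) f = (X i - X (i + 1)) * divDiff i f :=
  (sub_swap_dvd i f).choose_spec

/-- The isobaric divided difference `f ↦ ∂_i ((1 - x_{i+1}) f)`. -/
noncomputable def isobaric (i : ℕ) (f : MvPolynomial ℕ ℤ) : MvPolynomial ℕ ℤ :=
  divDiff i ((1 - X (i + 1)) * f)

/-- The pairs of positions below `N` that are not inverted by `w`. -/
def nonInv (N : ℕ) (w : Equiv.Perm ℕ) : Finset (ℕ × ℕ) :=
  (Finset.range N ×ˢ Finset.range N).filter fun p => p.1 < p.2 ∧ w p.1 < w p.2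

theorem card_nonInv_lt {N i : ℕ} {w : Equiv.Perm ℕ} (hN : i + 1 < N) (h : w i < w (i + 1)) :
    (nonInv N (w * Equiv.swap i (i + 1))).card < (nonInv N w).card := by
  have hmem : (i, i + 1) ∈ nonInv N w := by
    simp only [nonInv, Finset.mem_filter, Finset.mem_product, Finset.mem_range]
    exact ⟨⟨by omega, hN⟩, by omega, h⟩
  have hsw : ∀ a, Equiv.swap i (i + 1) a = if a = i then i + 1 else if a = i + 1 then i else a :=
    fun a => Equiv.swap_apply_def i (i + 1) a
  rw [← Finset.card_erase_add_one hmem, Nat.lt_succ_iff]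
  refine Finset.card_le_card_of_injOn
    (fun p => (Equiv.swap i (i + 1) p.1, Equiv.swap i (i + 1) p.2)) ?_ ?_
  · rintro ⟨a, b⟩ hab
    have hab' : (a, b) ∈ nonInv N (w * Equiv.swap i (i + 1)) := hab
    rw [nonInv, Finset.mem_filter, Finset.mem_product, Finset.mem_range, Finset.mem_range,
      Equiv.Perm.mul_apply, Equiv.Perm.mul_apply] at hab'
    obtain ⟨⟨ha, hb⟩, hlt, hw⟩ := hab'
    have hne : ¬ (a = i ∧ b = i + 1) := by
      rintro ⟨rfl, rfl⟩
      rw [Equiv.swap_apply_left, Equiv.swap_apply_right] at hw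
      omega
    simp only [nonInv, Finset.coe_erase, Set.mem_sdiff, Finset.mem_coe, Finset.mem_filter,
      Finset.mem_product, Finset.mem_range, Set.mem_singleton_iff, Prod.mk.injEq]
    refine ⟨⟨⟨?_, ?_⟩, ?_, hw⟩, ?_⟩
    · rw [hsw]; split_ifs <;> omega
    · rw [hsw]; split_ifs <;> omega
    · rw [hsw, hsw]; split_ifs <;> omega
    · rw [hsw, hsw]; split_ifs <;> omega
  · rintro ⟨a, b⟩ - ⟨c, d⟩ - h
    simpa using h

/-- For `w` permuting `{0, …, N-1}` (and fixing the rest), the Grothendieck polynomial of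
`w ∈ S_N`: it is `x_1^{N-1} x_2^{N-2} ⋯ x_{N-1}` for the longest element of `S_N`, and
`𝔊_w = ∂_i ((1 - x_{i+1}) 𝔊_{w s_i})` if `w(i) < w(i+1)` (the first such `i` is used). -/
noncomputable def grothendieckAux (N : ℕ) (w : Equiv.Perm ℕ) : MvPolynomial ℕ ℤ :=
  open Classical in
  if h : ∃ i, i + 1 < N ∧ w i < w (i + 1) then
    isobaric (Nat.find h) (grothendieckAux N (w * Equiv.swap (Nat.find h) (Nat.find h + 1)))
  else ∏ i ∈ Finset.range N, X i ^ (N - 1 - i)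
termination_by (nonInv N w).card
decreasing_by
  exact card_nonInv_lt (Nat.find_spec h).1 (Nat.find_spec h).2

/-- The Grothendieck polynomial `𝔊_w(x)` for `w ∈ S_∞`, computed in the smallest `S_N` that
contains `w`. -/
noncomputable def grothendieck (w : SInf) : MvPolynomial ℕ ℤ :=
  open Classical in grothendieckAux (Nat.find w.2) w.1

/-- `c` is a family of structure constants for `𝔊_u 𝔊_v`: the integers `c w`, `w ∈ S_∞`, almost
all zero, satisfy `𝔊_u 𝔊_v = ∑_w c_w 𝔊_w`. -/
def IsStructureConstants (u v : SInf) (c : SInf →₀ ℤ) : Prop :=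
  grothendieck u * grothendieck v = c.sum fun w a => a • grothendieck w

/-! ### The quadratic algebra -/

/-- Index set of the generators `[ij]`, `i ≠ j`. -/
abbrev Gen (n : ℕ) : Type := {p : Fin n × Fin n // p.1 ≠ p.2}

/-- The generator `[ij]` in the free associative algebra. -/
def freeGen {n : ℕ} (i j : Fin n) (h : i ≠ j) : FreeAlgebra ℤ (Gen n) :=
  FreeAlgebra.ι ℤ ⟨(i, j), h⟩

/-- The defining relations of the quadratic algebra `ℰ_n`. -/
inductive Rel (n : ℕ) : FreeAlgebra ℤ (Gen n) → FreeAlgebra ℤ (Gen n) → Prop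
  | antisymm (i j : Fin n) (h : i ≠ j) : Rel n (freeGen i j h + freeGen j i h.symm) 0
  | square (i j : Fin n) (h : i ≠ j) : Rel n (freeGen i j h * freeGen i j h) 0
  | triangle (i j k : Fin n) (hij : i ≠ j) (hjk : j ≠ k) (hki : k ≠ i) :
      Rel n (freeGen i j hij * freeGen j k hjk + freeGen j k hjk * freeGen k i hki
        + freeGen k i hki * freeGen i j hij) 0
  | comm (i j k l : Fin n) (hij : i ≠ j) (hkl : k ≠ l)
      (hik : i ≠ k) (hil : i ≠ l) (hjk : j ≠ k) (hjl : j ≠ l) :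
      Rel n (freeGen i j hij * freeGen k l hkl) (freeGen k l hkl * freeGen i j hij)

/-- The quadratic algebra `ℰ_n`. -/
abbrev QuadAlg (n : ℕ) : Type := RingQuot (Rel n)

/-- The element `[ij]` of `ℰ_n` (set to `0` in the unused case `i = j`). -/
noncomputable def bracket {n : ℕ} (i j : Fin n) : QuadAlg n :=
  if h : i ≠ j then RingQuot.mkAlgHom ℤ (Rel n) (freeGen i j h) else 0

/-- The `K`-theoretic Dunkl element
`κ_p = 1 - (1+[p-1,p])(1+[p-2,p])⋯(1+[1,p])(1+[n,p])(1+[n-1,p])⋯(1+[p+1,p])`. -/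
noncomputable def kappa {n : ℕ} (p : Fin n) : QuadAlg n :=
  1 - ((((List.finRange n).filter (· < p)).reverse ++
      ((List.finRange n).filter (p < ·)).reverse).map fun i => 1 + bracket i p).prod

/-- The value `f(a_0, a_1, …)` of a polynomial at elements of a possibly noncommutative ring; the
factors of each monomial are multiplied by increasing index (when the `a_i` commute, the order does
not matter). -/
noncomputable def evalAt {A : Type*} [Ring A] (a : ℕ → A) (f : MvPolynomial ℕ ℤ) : A :=
  ∑ m ∈ f.support, f.coeff m • ((m.support.sort (· ≤ ·)).map fun i => a i ^ m i).prod

/-- `f(κ_1, …, κ_{n-1})` for a polynomial `f` in `x_1, …, x_{n-1}` (any further variable is sent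
to `0`; none occurs in `𝔊_w` with `w ∈ S_n`). -/
noncomputable def evalKappa (n : ℕ) (f : MvPolynomial ℕ ℤ) : QuadAlg n :=
  evalAt (fun i => if h : i + 1 < n then kappa ⟨i, Nat.lt_of_succ_lt h⟩ else 0) f

/-! ### The Bruhat representation -/

/-- The free abelian group `ℤ⟨S_n⟩` on `S_n`. -/
abbrev ZS (n : ℕ) : Type := Equiv.Perm (Fin n) →₀ ℤ

/-- The operator of `[ij]`, `i < j`: it maps `w` to `w t_{ij}` if `l(w t_{ij}) = l(w) + 1`, and
to `0` otherwise. -/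
noncomputable def coverOp {n : ℕ} (i j : Fin n) : ZS n →ₗ[ℤ] ZS n :=
  Finsupp.linearCombination ℤ fun w : Equiv.Perm (Fin n) =>
    if length (w * Equiv.swap i j) = length w + 1 then
      Finsupp.single (w * Equiv.swap i j) (1 : ℤ) else 0

/-- The operator of an arbitrary generator, using `[ij] = -[ji]`. -/
noncomputable def bruhatOp {n : ℕ} (i j : Fin n) : ZS n →ₗ[ℤ] ZS n :=
  if i < j then coverOp i j else - coverOp j i

/-- Covering relations of the Bruhat order, in terms of positions and values. -/
def Cov {n : ℕ} (w : Equiv.Perm (Fin n)) (i j : Fin n) : Prop :=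
  w i < w j ∧ ∀ m, i < m → m < j → ¬ (w i < w m ∧ w m < w j)

theorem sum_pairs_split {n : ℕ} {i j : Fin n} (hij : i ≠ j) (g : Fin n → Fin n → ℤ) :
    ∑ a, ∑ b, g a b =
      (∑ a ∈ (Finset.univ.erase i).erase j, ∑ b ∈ (Finset.univ.erase i).erase j, g a b)
      + (∑ m ∈ (Finset.univ.erase i).erase j, (g m i + g i m + g m j + g j m))
      + (g i i + g i j + g j i + g j j) := by
  have hs : ∀ f : Fin n → ℤ,
      ∑ a, f a = (∑ a ∈ (Finset.univ.erase i).erase j, f a) + f j + f i := by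
    intro f
    rw [Finset.sum_erase_add _ _ (by simp [hij.symm]), Finset.sum_erase_add _ _ (by simp)]
  simp only [hs, Finset.sum_add_distrib]
  ring

theorem length_eq_sum {n : ℕ} (w : Equiv.Perm (Fin n)) :
    (length w : ℤ) = ∑ a, ∑ b, if a < b ∧ w b < w a then (1 : ℤ) else 0 := by
  rw [length, Finset.card_filter, Fintype.sum_prod_type]
  push_cast
  rfl

theorem length_mul_swap {n : ℕ} (w : Equiv.Perm (Fin n)) {i j : Fin n} (hij : i < j)
    (hw : w i < w j) :
    (length (w * Equiv.swap i j) : ℤ) = length w + 1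
      + 2 * ∑ m ∈ (Finset.univ.erase i).erase j,
          if i < m ∧ m < j ∧ w i < w m ∧ w m < w j then (1 : ℤ) else 0 := by
  have hsw : ∀ a, a ≠ i → a ≠ j → (w * Equiv.swap i j) a = w a := fun a h1 h2 => by
    rw [Equiv.Perm.mul_apply, Equiv.swap_apply_of_ne_of_ne h1 h2]
  have hi : (w * Equiv.swap i j) i = w j := by simp
  have hj : (w * Equiv.swap i j) j = w i := by simp
  rw [length_eq_sum, length_eq_sum, sum_pairs_split hij.ne, sum_pairs_split hij.ne, hi, hj]
  have h1 : (∑ a ∈ (Finset.univ.erase i).erase j, ∑ b ∈ (Finset.univ.erase i).erase j,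
        if a < b ∧ (w * Equiv.swap i j) b < (w * Equiv.swap i j) a then (1 : ℤ) else 0)
      = ∑ a ∈ (Finset.univ.erase i).erase j, ∑ b ∈ (Finset.univ.erase i).erase j,
        if a < b ∧ w b < w a then (1 : ℤ) else 0 := by
    refine Finset.sum_congr rfl fun a ha => Finset.sum_congr rfl fun b hb => ?_
    simp only [Finset.mem_erase, Finset.mem_univ, and_true] at ha hb
    rw [hsw a ha.2 ha.1, hsw b hb.2 hb.1]
  rw [h1]
  have h2 : (∑ m ∈ (Finset.univ.erase i).erase j,
        ((if m < i ∧ w j < (w * Equiv.swap i j) m then (1 : ℤ) else 0)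
        + (if i < m ∧ (w * Equiv.swap i j) m < w j then 1 else 0)
        + (if m < j ∧ w i < (w * Equiv.swap i j) m then 1 else 0)
        + (if j < m ∧ (w * Equiv.swap i j) m < w i then 1 else 0)))
      = (∑ m ∈ (Finset.univ.erase i).erase j,
        ((if m < i ∧ w i < w m then (1 : ℤ) else 0) + (if i < m ∧ w m < w i then 1 else 0)
        + (if m < j ∧ w j < w m then 1 else 0) + (if j < m ∧ w m < w j then 1 else 0)))
      + 2 * ∑ m ∈ (Finset.univ.erase i).erase j,
          if i < m ∧ m < j ∧ w i < w m ∧ w m < w j then (1 : ℤ) else 0 := by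
    rw [Finset.mul_sum, ← Finset.sum_add_distrib]
    refine Finset.sum_congr rfl fun m hm => ?_
    simp only [Finset.mem_erase, Finset.mem_univ, and_true] at hm
    rw [hsw m hm.2 hm.1]
    have e1 : w m ≠ w i := fun h => hm.2 (w.injective h)
    have e2 : w m ≠ w j := fun h => hm.1 (w.injective h)
    rcases lt_or_gt_of_ne hm.2 with a1 | a1 <;> rcases lt_or_gt_of_ne hm.1 with a2 | a2 <;>
      rcases lt_or_gt_of_ne e1 with a3 | a3 <;> rcases lt_or_gt_of_ne e2 with a4 | a4 <;>
      first
        | exact absurd (a1.trans hij) a2.asymm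
        | exact absurd (a3.trans hw) a4.asymm
        | simp [a1, a2, a3, a4, a1.asymm, a2.asymm, a3.asymm, a4.asymm]
  rw [h2]
  simp [hij, hw, hij.asymm, hw.asymm]
  ring

theorem length_swap_iff {n : ℕ} (w : Equiv.Perm (Fin n)) {i j : Fin n} (hij : i < j) :
    length (w * Equiv.swap i j) = length w + 1 ↔ Cov w i j := by
  have hnn : ∀ w' : Equiv.Perm (Fin n), 0 ≤ ∑ m ∈ (Finset.univ.erase i).erase j,
      if i < m ∧ m < j ∧ w' i < w' m ∧ w' m < w' j then (1 : ℤ) else 0 := fun w' =>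
    Finset.sum_nonneg fun m _ => by split_ifs <;> simp
  rcases lt_or_gt_of_ne (fun h => hij.ne (w.injective h) : w i ≠ w j) with hw | hw
  · have key := length_mul_swap w hij hw
    have h0 : length (w * Equiv.swap i j) = length w + 1 ↔
        (∑ m ∈ (Finset.univ.erase i).erase j,
          if i < m ∧ m < j ∧ w i < w m ∧ w m < w j then (1 : ℤ) else 0) = 0 := by omega
    rw [h0, Finset.sum_eq_zero_iff_of_nonneg (fun m _ => by split_ifs <;> simp)]
    simp only [Finset.mem_erase, Finset.mem_univ, and_true, ite_eq_right_iff, one_ne_zero,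
      imp_false, Cov]
    constructor
    · intro h
      exact ⟨hw, fun m h1 h2 h3 => h m ⟨h2.ne, h1.ne'⟩ ⟨h1, h2, h3⟩⟩
    · rintro ⟨-, h⟩ m - ⟨h1, h2, h3⟩
      exact h m h1 h2 h3
  · have key := length_mul_swap (w * Equiv.swap i j) hij (by simpa using hw)
    have := hnn (w * Equiv.swap i j)
    rw [mul_assoc, Equiv.swap_mul_self, mul_one] at key
    constructor
    · intro h; omega
    · intro h; exact absurd h.1 hw.asymm

open Classical in
/-- The coefficient of `w t_{ij}` in `[ij] w`. -/
noncomputable def sgnCov {n : ℕ} (w : Equiv.Perm (Fin n)) (i j : Fin n) : ℤ :=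
  if i < j then (if Cov w i j then 1 else 0) else -(if Cov w j i then 1 else 0)

theorem bruhatOp_single {n : ℕ} (w : Equiv.Perm (Fin n)) (i j : Fin n) (h : i ≠ j) :
    bruhatOp i j (Finsupp.single w 1) =
      sgnCov w i j • Finsupp.single (w * Equiv.swap i j) 1 := by
  rcases lt_or_gt_of_ne h with h | h
  · rw [bruhatOp, if_pos h, coverOp, Finsupp.linearCombination_single, one_smul, sgnCov, if_pos h]
    have hl := length_swap_iff w h
    by_cases hc : Cov w i j
    · simp [hc, hl.mpr hc]
    · simp [hc, mt hl.mp hc]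
  · rw [bruhatOp, if_neg h.asymm, LinearMap.neg_apply, coverOp, Finsupp.linearCombination_single,
      one_smul, sgnCov, if_neg h.asymm, Equiv.swap_comm i j]
    have hl := length_swap_iff w h
    by_cases hc : Cov w j i
    · simp [hc, hl.mpr hc]
    · simp [hc, mt hl.mp hc]

theorem sgnCov_antisymm {n : ℕ} (w : Equiv.Perm (Fin n)) (i j : Fin n) (h : i ≠ j) :
    sgnCov w i j = - sgnCov w j i := by
  rcases lt_or_gt_of_ne h with h | h <;> simp [sgnCov, h, h.asymm]

theorem bruhat_antisymm {n : ℕ} (i j : Fin n) (h : i ≠ j) :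
    bruhatOp i j + bruhatOp j i = 0 := by
  rcases lt_or_gt_of_ne h with h | h <;> simp [bruhatOp, h, h.asymm]

theorem bruhat_comp_single {n : ℕ} (w : Equiv.Perm (Fin n)) (i j k l : Fin n) (hij : i ≠ j)
    (hkl : k ≠ l) :
    (bruhatOp k l ∘ₗ bruhatOp i j) (Finsupp.single w 1) =
      (sgnCov w i j * sgnCov (w * Equiv.swap i j) k l) •
        Finsupp.single (w * (Equiv.swap i j * Equiv.swap k l)) 1 := by
  rw [LinearMap.comp_apply, bruhatOp_single w i j hij, map_smul, bruhatOp_single _ k l hkl,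
    smul_smul, mul_assoc]

theorem bruhat_square {n : ℕ} (i j : Fin n) (h : i ≠ j) :
    bruhatOp i j ∘ₗ bruhatOp i j = 0 := by
  refine Finsupp.lhom_ext' fun w => LinearMap.ext_ring ?_
  change (bruhatOp i j ∘ₗ bruhatOp i j) (Finsupp.single w 1) = 0
  rw [bruhat_comp_single w i j i j h h]
  suffices sgnCov w i j * sgnCov (w * Equiv.swap i j) i j = 0 by rw [this, zero_smul]
  simp only [sgnCov, Cov]
  grind [Equiv.Perm.mul_apply, Equiv.swap_apply_left, Equiv.swap_apply_right]

theorem swap_vals {n : ℕ} (w : Equiv.Perm (Fin n)) (i j : Fin n) :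
    (w * Equiv.swap i j) i = w j ∧ (w * Equiv.swap i j) j = w i ∧
      ∀ m, m ≠ i → m ≠ j → (w * Equiv.swap i j) m = w m := by
  refine ⟨by simp, by simp, fun m h1 h2 => ?_⟩
  rw [Equiv.Perm.mul_apply, Equiv.swap_apply_of_ne_of_ne h1 h2]

theorem cov_triangle {n : ℕ} (w : Equiv.Perm (Fin n)) {i j k : Fin n} (hij : i < j) (hjk : j < k) :
    ((Cov w i j ∧ Cov (w * Equiv.swap i j) j k) ↔
      (Cov w j k ∧ Cov (w * Equiv.swap j k) i k) ∨ (Cov w i k ∧ Cov (w * Equiv.swap i k) i j)) ∧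
    ¬ ((Cov w j k ∧ Cov (w * Equiv.swap j k) i k) ∧
      (Cov w i k ∧ Cov (w * Equiv.swap i k) i j)) := by
  obtain ⟨a1, a2, a3⟩ := swap_vals w i j
  obtain ⟨b1, b2, b3⟩ := swap_vals w j k
  obtain ⟨c1, c2, c3⟩ := swap_vals w i k
  have inj : ∀ x y, x ≠ y → w x ≠ w y := fun x y h1 h2 => h1 (w.injective h2)
  unfold Cov
  generalize (w * Equiv.swap i j) = w1 at *
  generalize (w * Equiv.swap j k) = w2 at *
  generalize (w * Equiv.swap i k) = w3 at *
  grind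

theorem cov_triangle' {n : ℕ} (w : Equiv.Perm (Fin n)) {i j k : Fin n} (hij : i < j)
    (hjk : j < k) :
    ((Cov w j k ∧ Cov (w * Equiv.swap j k) i j) ↔
      (Cov w i j ∧ Cov (w * Equiv.swap i j) i k) ∨ (Cov w i k ∧ Cov (w * Equiv.swap i k) j k)) ∧
    ¬ ((Cov w i j ∧ Cov (w * Equiv.swap i j) i k) ∧
      (Cov w i k ∧ Cov (w * Equiv.swap i k) j k)) := by
  obtain ⟨a1, a2, a3⟩ := swap_vals w i j
  obtain ⟨b1, b2, b3⟩ := swap_vals w j k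
  obtain ⟨c1, c2, c3⟩ := swap_vals w i k
  have inj : ∀ x y, x ≠ y → w x ≠ w y := fun x y h1 h2 => h1 (w.injective h2)
  unfold Cov
  generalize (w * Equiv.swap i j) = w1 at *
  generalize (w * Equiv.swap j k) = w2 at *
  generalize (w * Equiv.swap i k) = w3 at *
  grind

theorem cov_comm {n : ℕ} (w : Equiv.Perm (Fin n)) {i j k l : Fin n} (hij : i < j) (hkl : k < l)
    (hik : i ≠ k) (hil : i ≠ l) (hjk : j ≠ k) (hjl : j ≠ l)
    (h : Cov w i j ∧ Cov (w * Equiv.swap i j) k l) :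
    Cov w k l ∧ Cov (w * Equiv.swap k l) i j := by
  obtain ⟨a1, a2, a3⟩ := swap_vals w i j
  obtain ⟨b1, b2, b3⟩ := swap_vals w k l
  have inj : ∀ x y, x ≠ y → w x ≠ w y := fun x y h1 h2 => h1 (w.injective h2)
  have n1 := inj _ _ hik
  have n2 := inj _ _ hil
  have n3 := inj _ _ hjk
  have n4 := inj _ _ hjl
  clear inj
  unfold Cov at *
  generalize (w * Equiv.swap i j) = w1 at *
  generalize (w * Equiv.swap k l) = w2 at *
  grind

theorem sgn_triangle {n : ℕ} (w : Equiv.Perm (Fin n)) {i j k : Fin n} (hij : i < j)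
    (hjk : j < k) :
    sgnCov w i j * sgnCov (w * Equiv.swap i j) j k
      + sgnCov w j k * sgnCov (w * Equiv.swap j k) k i
      + sgnCov w k i * sgnCov (w * Equiv.swap k i) i j = 0 := by
  obtain ⟨h1, h2⟩ := cov_triangle w hij hjk
  have hik := hij.trans hjk
  rw [Equiv.swap_comm k i]
  simp only [sgnCov, if_pos hij, if_pos hjk, if_neg hik.asymm]
  grind

theorem sgn_triangle' {n : ℕ} (w : Equiv.Perm (Fin n)) {i j k : Fin n} (hij : i < j)
    (hjk : j < k) :
    sgnCov w k j * sgnCov (w * Equiv.swap k j) j i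
      + sgnCov w j i * sgnCov (w * Equiv.swap j i) i k
      + sgnCov w i k * sgnCov (w * Equiv.swap i k) k j = 0 := by
  obtain ⟨h1, h2⟩ := cov_triangle' w hij hjk
  have hik := hij.trans hjk
  rw [Equiv.swap_comm k j, Equiv.swap_comm j i]
  simp only [sgnCov, if_pos hik, if_neg hij.asymm, if_neg hjk.asymm]
  grind

theorem bruhat_triangle {n : ℕ} (i j k : Fin n) (hij : i ≠ j) (hjk : j ≠ k) (hki : k ≠ i) :
    bruhatOp j k ∘ₗ bruhatOp i j + bruhatOp k i ∘ₗ bruhatOp j k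
      + bruhatOp i j ∘ₗ bruhatOp k i = 0 := by
  refine Finsupp.lhom_ext' fun w => LinearMap.ext_ring ?_
  change (bruhatOp j k ∘ₗ bruhatOp i j) (Finsupp.single w 1)
    + (bruhatOp k i ∘ₗ bruhatOp j k) (Finsupp.single w 1)
    + (bruhatOp i j ∘ₗ bruhatOp k i) (Finsupp.single w 1) = 0
  rw [bruhat_comp_single w i j j k hij hjk, bruhat_comp_single w j k k i hjk hki,
    bruhat_comp_single w k i i j hki hij]
  have e1 : Equiv.swap j k * Equiv.swap k i = Equiv.swap i j * Equiv.swap j k := by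
    ext x; simp only [Equiv.Perm.mul_apply, Equiv.swap_apply_def]; grind
  have e2 : Equiv.swap k i * Equiv.swap i j = Equiv.swap i j * Equiv.swap j k := by
    ext x; simp only [Equiv.Perm.mul_apply, Equiv.swap_apply_def]; grind
  rw [e1, e2, ← add_smul, ← add_smul]
  suffices h : sgnCov w i j * sgnCov (w * Equiv.swap i j) j k
      + sgnCov w j k * sgnCov (w * Equiv.swap j k) k i
      + sgnCov w k i * sgnCov (w * Equiv.swap k i) i j = 0 by rw [h, zero_smul]
  rcases lt_or_gt_of_ne hij with a | a <;> rcases lt_or_gt_of_ne hjk with b | b <;>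
    rcases lt_or_gt_of_ne hki with c | c
  · exact absurd (a.trans b) c.asymm
  · exact sgn_triangle w a b
  · linarith [sgn_triangle w c a]
  · linarith [sgn_triangle' w c b]
  · linarith [sgn_triangle w b c]
  · linarith [sgn_triangle' w a c]
  · linarith [sgn_triangle' w b a]
  · exact absurd (b.trans a) c.asymm

theorem bruhat_comm {n : ℕ} (i j k l : Fin n) (hij : i ≠ j) (hkl : k ≠ l)
    (hik : i ≠ k) (hil : i ≠ l) (hjk : j ≠ k) (hjl : j ≠ l) :
    bruhatOp k l ∘ₗ bruhatOp i j = bruhatOp i j ∘ₗ bruhatOp k l := by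
  refine Finsupp.lhom_ext' fun w => LinearMap.ext_ring ?_
  change (bruhatOp k l ∘ₗ bruhatOp i j) (Finsupp.single w 1)
    = (bruhatOp i j ∘ₗ bruhatOp k l) (Finsupp.single w 1)
  rw [bruhat_comp_single w i j k l hij hkl, bruhat_comp_single w k l i j hkl hij]
  have e1 : Equiv.swap k l * Equiv.swap i j = Equiv.swap i j * Equiv.swap k l := by
    ext x; simp only [Equiv.Perm.mul_apply, Equiv.swap_apply_def]; grind
  rw [e1]
  congr 1
  have key : ∀ {a b c d : Fin n}, a < b → c < d → a ≠ c → a ≠ d → b ≠ c → b ≠ d →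
      sgnCov w a b * sgnCov (w * Equiv.swap a b) c d
        = sgnCov w c d * sgnCov (w * Equiv.swap c d) a b := by
    intro a b c d hab hcd h1 h2 h3 h4
    have p := cov_comm w hab hcd h1 h2 h3 h4
    have q := cov_comm w hcd hab h1.symm h3.symm h2.symm h4.symm
    simp only [sgnCov, if_pos hab, if_pos hcd]
    grind
  rcases lt_or_gt_of_ne hij with a | a <;> rcases lt_or_gt_of_ne hkl with b | b
  · exact key a b hik hil hjk hjl
  · rw [sgnCov_antisymm _ k l hkl, sgnCov_antisymm w k l hkl, Equiv.swap_comm k l]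
    linarith [key a b hil hik hjl hjk]
  · rw [sgnCov_antisymm w i j hij, sgnCov_antisymm _ i j hij, Equiv.swap_comm i j]
    linarith [key a b hjk hjl hik hil]
  · rw [sgnCov_antisymm w i j hij, sgnCov_antisymm _ i j hij, sgnCov_antisymm _ k l hkl,
      sgnCov_antisymm w k l hkl, Equiv.swap_comm i j, Equiv.swap_comm k l]
    linarith [key a b hjl hjk hil hik]

open MulOpposite in
/-- The Bruhat representation of `ℰ_n` on `ℤ⟨S_n⟩`. A monomial `[ij][kl]⋯` acts by applying first
`[ij]`, then `[kl]`, and so on: the target is the opposite of the endomorphism ring. -/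
noncomputable def bruhat (n : ℕ) : QuadAlg n →ₐ[ℤ] (Module.End ℤ (ZS n))ᵐᵒᵖ :=
  RingQuot.liftAlgHom ℤ (s := Rel n)
    ⟨FreeAlgebra.lift ℤ fun p : Gen n => op (bruhatOp p.1.1 p.1.2), by
      intro x y h
      cases h with
      | antisymm i j h =>
        simp only [freeGen, map_add, map_zero, FreeAlgebra.lift_ι_apply, ← op_add,
          bruhat_antisymm i j h, op_zero]
      | square i j h =>
        simp only [freeGen, map_mul, map_zero, FreeAlgebra.lift_ι_apply, ← op_mul,
          Module.End.mul_eq_comp, bruhat_square i j h, op_zero]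
      | triangle i j k hij hjk hki =>
        simp only [freeGen, map_add, map_mul, map_zero, FreeAlgebra.lift_ι_apply, ← op_mul,
          ← op_add, Module.End.mul_eq_comp, bruhat_triangle i j k hij hjk hki, op_zero]
      | comm i j k l hij hkl hik hil hjk hjl =>
        simp only [freeGen, map_mul, FreeAlgebra.lift_ι_apply, ← op_mul,
          Module.End.mul_eq_comp, bruhat_comm i j k l hij hkl hik hil hjk hjl]⟩

/-- `e v`, the result of acting with `e ∈ ℰ_n` on `v ∈ S_n ⊆ ℤ⟨S_n⟩`. -/
noncomputable def bruhatAct {n : ℕ} (e : QuadAlg n) (v : Equiv.Perm (Fin n)) : ZS n :=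
  (bruhat n e).unop (Finsupp.single v 1)

end KFlag

/-!
The isobaric divided differences act on the basis of Grothendieck polynomials as the Demazure
operators of `S_∞`, which send `w` to `w s_i` at a descent and fix it otherwise. In the Bruhat
representation the Demazure operators of `S_n` have the form `(1 + [i, i+1]) d`, and by the
Yang–Baxter relation for the factors `1 + [ij]` they satisfy the same commutation rules with
`1 - κ_p` as the isobaric divided differences with multiplication by `1 - x_p`. Hence the span of
the defects between these two actions is stable under all Demazure operators. Its elements have
coefficient `0` at the identity, because `1 - κ_p` preserves this coefficient, as `1 - x_p`
preserves the constant term. By induction on the length, a stable subgroup all of whose elements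
have coefficient `0` at the identity vanishes, so that `κ_p` acts as multiplication by `x_p`.
-/

namespace KFlag

open MvPolynomial

/-! ### Divided differences -/

/-- The action of the simple transposition `s_i` on polynomials, interchanging `X i` and
`X (i + 1)`. -/
noncomputable abbrev swapVars (i : ℕ) : MvPolynomial ℕ ℤ →ₐ[ℤ] MvPolynomial ℕ ℤ :=
  rename (Equiv.swap i (i + 1))

section SwapVars

variable {i j : ℕ}

theorem swap_succ_mul_comm (h : i + 1 < j) :
    Equiv.swap i (i + 1) * Equiv.swap j (j + 1) = Equiv.swap j (j + 1) * Equiv.swap i (i + 1) :=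
  (Equiv.Perm.disjoint_swap_swap (by simp; omega)).commute

theorem swap_succ_braid (i : ℕ) :
    Equiv.swap i (i + 1) * Equiv.swap (i + 1) (i + 2) * Equiv.swap i (i + 1) =
      Equiv.swap (i + 1) (i + 2) * Equiv.swap i (i + 1) * Equiv.swap (i + 1) (i + 2) := by
  rw [Equiv.swap_mul_swap_mul_swap (by omega) (by omega), Equiv.swap_comm i (i + 1),
    Equiv.swap_comm (i + 1) (i + 2), Equiv.swap_mul_swap_mul_swap (by omega) (by omega),
    Equiv.swap_comm]

theorem swapVars_X_left (i : ℕ) : swapVars i (X i) = X (i + 1) := by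
  rw [rename_X, Equiv.swap_apply_left]

theorem swapVars_X_right (i : ℕ) : swapVars i (X (i + 1)) = X i := by
  rw [rename_X, Equiv.swap_apply_right]

theorem swapVars_X_of_ne (h : j ≠ i) (h' : j ≠ i + 1) : swapVars i (X j) = X j := by
  rw [rename_X, Equiv.swap_apply_of_ne_of_ne h h']

theorem swapVars_one_sub_X_of_ne (h : j ≠ i) (h' : j ≠ i + 1) :
    swapVars i (1 - X j) = 1 - X j := by
  rw [map_sub, map_one, swapVars_X_of_ne h h']

theorem swapVars_swapVars (i : ℕ) (f : MvPolynomial ℕ ℤ) : swapVars i (swapVars i f) = f := by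
  rw [rename_rename, ← Equiv.Perm.coe_mul, Equiv.swap_mul_self, Equiv.Perm.coe_one, rename_id_apply]

theorem swapVars_comm (h : i + 1 < j) (f : MvPolynomial ℕ ℤ) :
    swapVars i (swapVars j f) = swapVars j (swapVars i f) := by
  rw [rename_rename, rename_rename, ← Equiv.Perm.coe_mul, ← Equiv.Perm.coe_mul,
    swap_succ_mul_comm h]

theorem swapVars_braid (i : ℕ) (f : MvPolynomial ℕ ℤ) :
    swapVars i (swapVars (i + 1) (swapVars i f)) =
      swapVars (i + 1) (swapVars i (swapVars (i + 1) f)) := by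
  simp only [rename_rename, ← Equiv.Perm.coe_mul, ← mul_assoc, swap_succ_braid]

end SwapVars

section DivDiff

variable {i j : ℕ} {f q : MvPolynomial ℕ ℤ}

theorem X_sub_X_ne_zero (h : i ≠ j) : (X i - X j : MvPolynomial ℕ ℤ) ≠ 0 :=
  sub_ne_zero.mpr fun e => h (X_injective e)

theorem divDiff_eq (h : (X i - X (i + 1)) * q = f - swapVars i f) : divDiff i f = q :=
  mul_left_cancel₀ (X_sub_X_ne_zero (Nat.lt_succ_self i).ne) ((divDiff_spec i f).symm.trans h.symm)

theorem divDiff_add (i : ℕ) (f g : MvPolynomial ℕ ℤ) :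
    divDiff i (f + g) = divDiff i f + divDiff i g :=
  divDiff_eq <| by rw [map_add, mul_add, ← divDiff_spec, ← divDiff_spec]; ring

theorem divDiff_mul (i : ℕ) (f g : MvPolynomial ℕ ℤ) :
    divDiff i (f * g) = divDiff i f * g + swapVars i f * divDiff i g :=
  divDiff_eq <| by
    rw [map_mul]
    linear_combination -g * divDiff_spec i f - swapVars i f * divDiff_spec i g

theorem divDiff_of_swapVars_eq (h : swapVars i f = f) : divDiff i f = 0 :=
  divDiff_eq <| by rw [h, sub_self, mul_zero]

theorem divDiff_mul_of_swapVars_eq (h : swapVars i f = f) (g : MvPolynomial ℕ ℤ) :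
    divDiff i (f * g) = f * divDiff i g := by
  rw [divDiff_mul, divDiff_of_swapVars_eq h, h, zero_mul, zero_add]

theorem divDiff_one_sub_X_succ (i : ℕ) : divDiff i (1 - X (i + 1)) = 1 :=
  divDiff_eq <| by rw [map_sub, map_one, swapVars_X_right]; ring

theorem swapVars_divDiff (i : ℕ) (f : MvPolynomial ℕ ℤ) :
    swapVars i (divDiff i f) = divDiff i f := by
  have h := congrArg (swapVars i) (divDiff_spec i f)
  rw [map_mul, map_sub, map_sub, swapVars_swapVars, swapVars_X_left, swapVars_X_right] at h
  exact (divDiff_eq (by linear_combination h)).symm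

theorem divDiff_comm (h : i + 1 < j) (f : MvPolynomial ℕ ℤ) :
    divDiff i (divDiff j f) = divDiff j (divDiff i f) := by
  have hi : swapVars i (X j - X (j + 1)) = X j - X (j + 1) := by
    rw [map_sub, swapVars_X_of_ne (by omega) (by omega), swapVars_X_of_ne (by omega) (by omega)]
  have hj : swapVars j (X i - X (i + 1)) = X i - X (i + 1) := by
    rw [map_sub, swapVars_X_of_ne (by omega) (by omega), swapVars_X_of_ne (by omega) (by omega)]
  have hij := congrArg (swapVars i) (divDiff_spec j f)
  have hji := congrArg (swapVars j) (divDiff_spec i f)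
  rw [map_sub, map_mul, hi] at hij
  rw [map_sub, map_mul, hj, ← swapVars_comm h] at hji
  refine divDiff_eq (mul_left_cancel₀ (X_sub_X_ne_zero (Nat.lt_succ_self j).ne) ?_)
  linear_combination -(X i - X (i + 1)) * divDiff_spec j (divDiff i f) - divDiff_spec i f + hji
    + divDiff_spec j f - hij

theorem X_sub_mul_divDiff_divDiff_succ (h : swapVars i f = f) :
    (X i - X (i + 1)) * (X (i + 1) - X (i + 2)) * (X i - X (i + 2)) *
        divDiff i (divDiff (i + 1) f) =
      (X i - X (i + 1)) * f - (X i - X (i + 2)) * swapVars (i + 1) f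
        + (X (i + 1) - X (i + 2)) * swapVars i (swapVars (i + 1) f) := by
  have h₂ := divDiff_spec (i + 1) f
  have h₁₂ := congrArg (swapVars i) h₂
  rw [map_sub, map_mul, map_sub, h, swapVars_X_right,
    swapVars_X_of_ne (j := i + 1 + 1) (by omega) (by omega)] at h₁₂
  linear_combination
    -(X (i + 1) - X (i + 2)) * (X i - X (i + 2)) * divDiff_spec i (divDiff (i + 1) f)
    - (X i - X (i + 2)) * h₂ + (X (i + 1) - X (i + 2)) * h₁₂

theorem X_sub_mul_divDiff_succ_divDiff (h : swapVars (i + 1) f = f) :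
    (X i - X (i + 1)) * (X (i + 1) - X (i + 2)) * (X i - X (i + 2)) *
        divDiff (i + 1) (divDiff i f) =
      (X (i + 1) - X (i + 2)) * f - (X i - X (i + 2)) * swapVars i f
        + (X i - X (i + 1)) * swapVars (i + 1) (swapVars i f) := by
  have h₁ := divDiff_spec i f
  have h₂₁ := congrArg (swapVars (i + 1)) h₁
  rw [map_sub, map_mul, map_sub, h, swapVars_X_left, swapVars_X_of_ne (by omega) (by omega)] at h₂₁
  linear_combination -(X i - X (i + 1)) * (X i - X (i + 2)) * divDiff_spec (i + 1) (divDiff i f)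
    - (X i - X (i + 2)) * h₁ + (X i - X (i + 1)) * h₂₁

/-- Multiplied by the Vandermonde determinant of the three variables, both sides become the
antisymmetrization of `f`. -/
theorem divDiff_braid (i : ℕ) (f : MvPolynomial ℕ ℤ) :
    divDiff i (divDiff (i + 1) (divDiff i f)) =
      divDiff (i + 1) (divDiff i (divDiff (i + 1) f)) := by
  have h₁ := divDiff_spec i f
  have h₂₁ := congrArg (swapVars (i + 1)) h₁
  have h₁₂₁ := congrArg (swapVars i) h₂₁
  have h₂ := divDiff_spec (i + 1) f
  have h₁₂ := congrArg (swapVars i) h₂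
  have h₂₁₂ := congrArg (swapVars (i + 1)) h₁₂
  have hX₂ : swapVars (i + 1) (X i) = X i := swapVars_X_of_ne (by omega) (by omega)
  have hX₁ : swapVars i (X (i + 1 + 1)) = X (i + 1 + 1) := swapVars_X_of_ne (by omega) (by omega)
  simp only [map_sub, map_mul, swapVars_X_left, swapVars_X_right, hX₁, hX₂] at h₂₁ h₁₂₁ h₁₂ h₂₁₂
  have hne : ((X i - X (i + 1)) * (X (i + 1) - X (i + 2)) * (X i - X (i + 2)) :
      MvPolynomial ℕ ℤ) ≠ 0 :=
    mul_ne_zero (mul_ne_zero (X_sub_X_ne_zero (by omega)) (X_sub_X_ne_zero (by omega)))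
      (X_sub_X_ne_zero (by omega))
  refine mul_left_cancel₀ hne ?_
  rw [X_sub_mul_divDiff_divDiff_succ (swapVars_divDiff i f),
    X_sub_mul_divDiff_succ_divDiff (swapVars_divDiff (i + 1) f)]
  linear_combination h₂₁ - h₁ - h₁₂₁ + h₂ - h₁₂ + h₂₁₂ - swapVars_braid i f

end DivDiff

/-! ### Isobaric divided differences -/

section Isobaric

variable {i j : ℕ} {f : MvPolynomial ℕ ℤ}

theorem isobaric_eq_add (i : ℕ) (f : MvPolynomial ℕ ℤ) :
    isobaric i f = f + (1 - X i) * divDiff i f := by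
  rw [isobaric, divDiff_mul, divDiff_one_sub_X_succ, one_mul, map_sub, map_one, swapVars_X_right]

/-- The isobaric divided difference as a linear map. -/
noncomputable def isobaricLin (i : ℕ) : MvPolynomial ℕ ℤ →ₗ[ℤ] MvPolynomial ℕ ℤ :=
  (AddMonoidHom.mk' (isobaric i) fun f g => by
    rw [isobaric, mul_add, divDiff_add, isobaric, isobaric]).toIntLinearMap

theorem isobaricLin_apply (i : ℕ) (f : MvPolynomial ℕ ℤ) : isobaricLin i f = isobaric i f := rfl

theorem swapVars_isobaric (i : ℕ) (f : MvPolynomial ℕ ℤ) :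
    swapVars i (isobaric i f) = isobaric i f :=
  swapVars_divDiff i _

theorem isobaric_of_swapVars_eq (h : swapVars i f = f) : isobaric i f = f := by
  rw [isobaric_eq_add, divDiff_of_swapVars_eq h, mul_zero, add_zero]

theorem isobaric_isobaric (i : ℕ) (f : MvPolynomial ℕ ℤ) :
    isobaric i (isobaric i f) = isobaric i f :=
  isobaric_of_swapVars_eq (swapVars_isobaric i f)

theorem isobaric_mul_of_swapVars_eq (h : swapVars i f = f) (g : MvPolynomial ℕ ℤ) :
    isobaric i (f * g) = f * isobaric i g := by
  rw [isobaric, mul_left_comm, divDiff_mul_of_swapVars_eq h, isobaric]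

theorem isobaric_X_mul_of_swapVars_eq (h : swapVars i f = f) : isobaric i (X i * f) = f := by
  have hX : divDiff i (X i) = 1 := divDiff_eq <| by rw [swapVars_X_left]; ring
  rw [isobaric_eq_add, divDiff_mul, divDiff_of_swapVars_eq h, hX]
  ring

theorem isobaric_mul_left (i : ℕ) (f : MvPolynomial ℕ ℤ) :
    isobaric i ((1 - X i) * f) = (1 - X (i + 1)) * (isobaric i f - f) := by
  have hX : divDiff i (1 - X i) = -1 := divDiff_eq <| by
    rw [map_sub, map_one, swapVars_X_left]; ring
  rw [isobaric_eq_add, isobaric_eq_add, divDiff_mul, hX, map_sub, map_one, swapVars_X_left]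
  ring

theorem isobaric_mul_right (i : ℕ) (f : MvPolynomial ℕ ℤ) :
    isobaric i ((1 - X (i + 1)) * f) = (1 - X (i + 1)) * f + (1 - X i) * isobaric i f := by
  rw [isobaric_eq_add, isobaric]

theorem isobaric_comm (h : i + 1 < j) (f : MvPolynomial ℕ ℤ) :
    isobaric i (isobaric j f) = isobaric j (isobaric i f) := by
  have hi : swapVars i (1 - X (j + 1)) = 1 - X (j + 1) :=
    swapVars_one_sub_X_of_ne (by omega) (by omega)
  have hj : swapVars j (1 - X (i + 1)) = 1 - X (i + 1) :=
    swapVars_one_sub_X_of_ne (by omega) (by omega)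
  calc isobaric i (isobaric j f)
      = divDiff i (divDiff j ((1 - X (i + 1)) * ((1 - X (j + 1)) * f))) := by
        rw [divDiff_mul_of_swapVars_eq hj]; rfl
    _ = divDiff j (divDiff i ((1 - X (j + 1)) * ((1 - X (i + 1)) * f))) := by
        rw [divDiff_comm h, mul_left_comm]
    _ = isobaric j (isobaric i f) := by rw [divDiff_mul_of_swapVars_eq hi]; rfl

theorem isobaric_isobaric_succ_isobaric (i : ℕ) (f : MvPolynomial ℕ ℤ) :
    isobaric i (isobaric (i + 1) (isobaric i f)) =
      divDiff i (divDiff (i + 1) (divDiff i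
        ((1 - X (i + 2)) ^ 2 * ((1 - X (i + 1)) * f)))) := by
  have hX : swapVars i (1 - X (i + 2)) = 1 - X (i + 2) :=
    swapVars_one_sub_X_of_ne (by omega) (by omega)
  have h₁ : divDiff i ((1 - X (i + 2)) * isobaric i f) = 0 :=
    divDiff_of_swapVars_eq (by rw [map_mul, hX, swapVars_isobaric])
  have h₂ := isobaric_mul_right (i + 1) (isobaric i f)
  calc isobaric i (isobaric (i + 1) (isobaric i f))
      = divDiff i ((1 - X (i + 2)) * isobaric i f
          + (1 - X (i + 1)) * isobaric (i + 1) (isobaric i f)) := by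
        rw [divDiff_add, h₁, zero_add]; rfl
    _ = divDiff i (divDiff (i + 1) ((1 - X (i + 2)) ^ 2 * isobaric i f)) := by
        rw [← h₂, isobaric, ← mul_assoc, ← sq]
    _ = _ := by
        rw [divDiff_mul_of_swapVars_eq (i := i) (by rw [map_pow, hX])]; rfl

theorem isobaric_succ_isobaric_isobaric_succ (i : ℕ) (f : MvPolynomial ℕ ℤ) :
    isobaric (i + 1) (isobaric i (isobaric (i + 1) f)) =
      divDiff (i + 1) (divDiff i (divDiff (i + 1)
        ((1 - X (i + 2)) ^ 2 * ((1 - X (i + 1)) * f)))) := by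
  have h₁ : swapVars i (1 - X (i + 2)) = 1 - X (i + 2) :=
    swapVars_one_sub_X_of_ne (by omega) (by omega)
  have h₂ : swapVars (i + 1) ((1 - X (i + 2)) * (1 - X (i + 1))) =
      (1 - X (i + 2)) * (1 - X (i + 1)) := by
    rw [map_mul, map_sub, map_sub, map_one, swapVars_X_left,
      show i + 2 = i + 1 + 1 from rfl, swapVars_X_right, mul_comm]
  have h : (1 - X (i + 2)) ^ 2 * ((1 - X (i + 1)) * f) =
      (1 - X (i + 2)) * (1 - X (i + 1)) * ((1 - X (i + 2)) * f) := by ring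
  rw [h, divDiff_mul_of_swapVars_eq h₂, mul_assoc, divDiff_mul_of_swapVars_eq h₁]
  rfl

theorem isobaric_braid (i : ℕ) (f : MvPolynomial ℕ ℤ) :
    isobaric i (isobaric (i + 1) (isobaric i f)) =
      isobaric (i + 1) (isobaric i (isobaric (i + 1) f)) := by
  rw [isobaric_isobaric_succ_isobaric, isobaric_succ_isobaric_isobaric_succ, divDiff_braid]

end Isobaric

/-! ### The recursion for Grothendieck polynomials at an arbitrary ascent -/

section Recursion

variable {N i j : ℕ} {w : Equiv.Perm ℕ}

theorem nonInv_induction {P : Equiv.Perm ℕ → Prop}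
    (h : ∀ w, (∀ i, i + 1 < N → w i < w (i + 1) → P (w * Equiv.swap i (i + 1))) → P w)
    (w : Equiv.Perm ℕ) : P w := by
  induction hk : (nonInv N w).card using Nat.strong_induction_on generalizing w with
  | _ k ih =>
    exact h w fun i hi hw => ih _ (hk ▸ card_nonInv_lt hi hw) _ rfl

theorem mul_swap_succ_apply_of_ne (w : Equiv.Perm ℕ) (h : j ≠ i) (h' : j ≠ i + 1) :
    (w * Equiv.swap i (i + 1)) j = w j := by
  rw [Equiv.Perm.mul_apply, Equiv.swap_apply_of_ne_of_ne h h']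

theorem mul_swap_succ_apply_left (w : Equiv.Perm ℕ) (i : ℕ) :
    (w * Equiv.swap i (i + 1)) i = w (i + 1) := by
  rw [Equiv.Perm.mul_apply, Equiv.swap_apply_left]

theorem mul_swap_succ_apply_right (w : Equiv.Perm ℕ) (i : ℕ) :
    (w * Equiv.swap i (i + 1)) (i + 1) = w i := by
  rw [Equiv.Perm.mul_apply, Equiv.swap_apply_right]

theorem succ_lt_of_not_lt (h : ¬ w i < w (i + 1)) : w (i + 1) < w i :=
  (not_lt.mp h).lt_of_ne (w.injective.ne (Nat.succ_ne_self i))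

/-- The defining recursion of Grothendieck polynomials holds for `w` at each of its ascents below
`N`, not just at the first one, which `grothendieckAux` uses. -/
def AscentRecursion (N : ℕ) (w : Equiv.Perm ℕ) : Prop :=
  ∀ i, i + 1 < N → w i < w (i + 1) →
    grothendieckAux N w = isobaric i (grothendieckAux N (w * Equiv.swap i (i + 1)))

theorem exists_grothendieckAux_eq (h : ∃ i, i + 1 < N ∧ w i < w (i + 1)) :
    ∃ i, i + 1 < N ∧ w i < w (i + 1) ∧
      grothendieckAux N w = isobaric i (grothendieckAux N (w * Equiv.swap i (i + 1))) := by
  classical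
  refine ⟨Nat.find h, (Nat.find_spec h).1, (Nat.find_spec h).2, ?_⟩
  rw [grothendieckAux, dif_pos h]

theorem isobaric_grothendieckAux_eq_of_commute (hij : i + 1 < j) (hj : j + 1 < N)
    (hwi : w i < w (i + 1)) (hwj : w j < w (j + 1))
    (ri : AscentRecursion N (w * Equiv.swap i (i + 1)))
    (rj : AscentRecursion N (w * Equiv.swap j (j + 1))) :
    isobaric i (grothendieckAux N (w * Equiv.swap i (i + 1))) =
      isobaric j (grothendieckAux N (w * Equiv.swap j (j + 1))) := by
  have hwi' : (w * Equiv.swap j (j + 1)) i < (w * Equiv.swap j (j + 1)) (i + 1) := by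
    rwa [mul_swap_succ_apply_of_ne _ (by omega) (by omega),
      mul_swap_succ_apply_of_ne _ (by omega) (by omega)]
  have hwj' : (w * Equiv.swap i (i + 1)) j < (w * Equiv.swap i (i + 1)) (j + 1) := by
    rwa [mul_swap_succ_apply_of_ne _ (by omega) (by omega),
      mul_swap_succ_apply_of_ne _ (by omega) (by omega)]
  rw [ri j hj hwj', rj i (by omega) hwi', isobaric_comm hij, mul_assoc, mul_assoc,
    swap_succ_mul_comm hij]

theorem isobaric_grothendieckAux_eq_of_braid (hi : i + 2 < N)
    (hw : w i < w (i + 1)) (hw' : w (i + 1) < w (i + 2))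
    (r₁ : AscentRecursion N (w * Equiv.swap i (i + 1)))
    (r₂ : AscentRecursion N (w * Equiv.swap (i + 1) (i + 2)))
    (r₁₂ : AscentRecursion N (w * Equiv.swap i (i + 1) * Equiv.swap (i + 1) (i + 2)))
    (r₂₁ : AscentRecursion N (w * Equiv.swap (i + 1) (i + 2) * Equiv.swap i (i + 1))) :
    isobaric i (grothendieckAux N (w * Equiv.swap i (i + 1))) =
      isobaric (i + 1) (grothendieckAux N (w * Equiv.swap (i + 1) (i + 2))) := by
  have hs₁ : Equiv.swap i (i + 1) (i + 2) = i + 2 :=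
    Equiv.swap_apply_of_ne_of_ne (by omega) (by omega)
  have hs₂ : Equiv.swap (i + 1) (i + 2) i = i :=
    Equiv.swap_apply_of_ne_of_ne (by omega) (by omega)
  have hbraid : w * Equiv.swap i (i + 1) * Equiv.swap (i + 1) (i + 2) * Equiv.swap i (i + 1) =
      w * Equiv.swap (i + 1) (i + 2) * Equiv.swap i (i + 1) * Equiv.swap (i + 1) (i + 2) := by
    simp only [mul_assoc w, swap_succ_braid]
  rw [r₁ (i + 1) hi, r₁₂ i (by omega), r₂ i (by omega), r₂₁ (i + 1) hi, isobaric_braid, hbraid]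
  all_goals
    simp only [Equiv.Perm.mul_apply, Equiv.swap_apply_left, Equiv.swap_apply_right, hs₁, hs₂]
    omega

theorem isobaric_grothendieckAux_eq (hij : i < j) (hj : j + 1 < N)
    (hwi : w i < w (i + 1)) (hwj : w j < w (j + 1))
    (ih : ∀ v, (nonInv N v).card < (nonInv N w).card → AscentRecursion N v) :
    isobaric i (grothendieckAux N (w * Equiv.swap i (i + 1))) =
      isobaric j (grothendieckAux N (w * Equiv.swap j (j + 1))) := by
  have hi : i + 1 < N := by omega
  have hlti := card_nonInv_lt hi hwi
  have hltj := card_nonInv_lt hj hwj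
  rcases (Nat.succ_le_of_lt hij).eq_or_lt with rfl | hij'
  · refine isobaric_grothendieckAux_eq_of_braid hj hwi hwj (ih _ hlti) (ih _ hltj)
      (ih _ ((card_nonInv_lt hj ?_).trans hlti)) (ih _ ((card_nonInv_lt hi ?_).trans hltj))
    · rw [mul_swap_succ_apply_right, mul_swap_succ_apply_of_ne _ (by omega) (by omega)]
      exact hwi.trans hwj
    · rw [mul_swap_succ_apply_left, mul_swap_succ_apply_of_ne _ (by omega) (by omega)]
      exact hwi.trans hwj
  · exact isobaric_grothendieckAux_eq_of_commute hij' hj hwi hwj (ih _ hlti) (ih _ hltj)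

theorem ascentRecursion (N : ℕ) (w : Equiv.Perm ℕ) : AscentRecursion N w := by
  induction hk : (nonInv N w).card using Nat.strong_induction_on generalizing w with
  | _ k ih =>
    intro i hi hwi
    replace ih (v) (hv : (nonInv N v).card < (nonInv N w).card) := ih _ (hk ▸ hv) v rfl
    obtain ⟨j, hj, hwj, heq⟩ := exists_grothendieckAux_eq ⟨i, hi, hwi⟩
    rw [heq]
    rcases lt_trichotomy i j with hij | rfl | hij
    · exact (isobaric_grothendieckAux_eq hij hj hwi hwj ih).symm
    · rfl
    · exact isobaric_grothendieckAux_eq hij hi hwj hwi ih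

end Recursion

/-! ### Stability -/

section Stability

variable {N k : ℕ} {w : Equiv.Perm ℕ}

/-- The monomial `x_0^{N-1} x_1^{N-2} ⋯ x_{N-2}` of the longest element of `S_N`, times the
product of the variables `x_i` with `i ≤ N` in `T`. -/
noncomputable def stair (N : ℕ) (T : Finset ℕ) : MvPolynomial ℕ ℤ :=
  ∏ i ∈ Finset.range (N + 1), X i ^ (N - 1 - i + if i ∈ T then 1 else 0)

theorem stair_empty (N : ℕ) : stair N ∅ = ∏ i ∈ Finset.range N, X i ^ (N - 1 - i) := by
  simp [stair, Finset.prod_range_succ]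

theorem stair_range (N : ℕ) :
    stair N (Finset.range N) = ∏ i ∈ Finset.range (N + 1), X i ^ (N + 1 - 1 - i) := by
  refine Finset.prod_congr rfl fun i hi => ?_
  rw [Finset.mem_range] at hi
  simp only [Finset.mem_range]
  congr 1
  split_ifs <;> omega

theorem stair_insert {T : Finset ℕ} (hk : k ≤ N) (hT : k ∉ T) :
    stair N (insert k T) = X k * stair N T := by
  have hX : ∏ i ∈ Finset.range (N + 1), (if i = k then X i else 1) = (X k : MvPolynomial ℕ ℤ) := by
    rw [Finset.prod_ite_eq', if_pos (Finset.mem_range.mpr (by omega))]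
  rw [← hX, stair, stair, ← Finset.prod_mul_distrib]
  refine Finset.prod_congr rfl fun i _ => ?_
  rcases eq_or_ne i k with rfl | hik
  · simp only [Finset.mem_insert_self, if_true, if_neg hT, add_zero, pow_succ']
  · simp only [Finset.mem_insert, hik, false_or, if_false, one_mul]

theorem swapVars_prod_range {M : ℕ} (hk : k + 1 < M) {e : ℕ → ℕ} (he : e k = e (k + 1)) :
    swapVars k (∏ i ∈ Finset.range M, X i ^ e i) = ∏ i ∈ Finset.range M, X i ^ e i := by
  rw [map_prod]
  refine Finset.prod_equiv (Equiv.swap k (k + 1)) (fun i => ?_) fun i _ => ?_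
  · simp only [Finset.mem_range, Equiv.swap_apply_def]
    split_ifs <;> omega
  · rw [map_pow, rename_X]
    congr 1
    rw [Equiv.swap_apply_def]
    split_ifs with h h'
    · rw [h, he]
    · rw [h', he]
    · rfl

theorem isobaric_stair_insert {T : Finset ℕ} (hk : k < N) (hkT : k ∉ T)
    (hT : k + 1 ∈ T ↔ k + 1 < N) : isobaric k (stair N (insert k T)) = stair N T := by
  rw [stair_insert hk.le hkT]
  refine isobaric_X_mul_of_swapVars_eq (swapVars_prod_range (by omega) ?_)
  simp only [hkT, hT, if_false]
  split_ifs <;> omega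

theorem grothendieckAux_of_no_ascent (h : ∀ i, i + 1 < N → w (i + 1) < w i) :
    grothendieckAux N w = stair N ∅ := by
  rw [grothendieckAux, dif_neg, stair_empty]
  rintro ⟨i, hi, hw⟩
  exact hw.asymm (h i hi)

theorem grothendieckAux_succ_of_strictAntiOn (hk : k ≤ N)
    (hmax : ∀ a ≤ N, a ≠ k → w a < w k) (hanti : StrictAntiOn w (Set.Iic N \ {k})) :
    grothendieckAux (N + 1) w = stair N (Finset.Ico k N) := by
  induction k generalizing w with
  | zero =>
    rw [grothendieckAux_of_no_ascent, stair_empty, ← Finset.range_eq_Ico, stair_range]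
    rintro (_ | i) hi
    · exact hmax 1 (by omega) (by omega)
    · exact hanti ⟨Set.mem_Iic.mpr (by omega), by simp⟩ ⟨Set.mem_Iic.mpr (by omega), by simp⟩
        (Nat.lt_succ_self _)
  | succ k ih =>
    rw [ascentRecursion _ _ k (by omega) (hmax k (by omega) (by omega)), ih (by omega),
      ← Finset.insert_Ico_succ_left_eq_Ico hk]
    · exact isobaric_stair_insert hk (by simp) (by simp [Finset.mem_Ico])
    · intro a ha hak
      rw [mul_swap_succ_apply_left]
      rcases eq_or_ne a (k + 1) with rfl | hak'
      · rw [mul_swap_succ_apply_right]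
        exact hmax k (by omega) (by omega)
      · rw [mul_swap_succ_apply_of_ne _ hak hak']
        exact hmax a ha hak'
    · have hmem : Set.MapsTo (Equiv.swap k (k + 1)) (Set.Iic N \ {k}) (Set.Iic N \ {k + 1}) := by
        intro a
        simp only [Set.mem_sdiff, Set.mem_Iic, Set.mem_singleton_iff, Equiv.swap_apply_def]
        grind
      refine hanti.comp_strictMonoOn ?_ hmem
      intro a ha b hb hab
      simp only [Set.mem_sdiff, Set.mem_Iic, Set.mem_singleton_iff] at ha hb
      simp only [Equiv.swap_apply_def]
      grind

theorem apply_lt_of_fixed (h : ∀ i, N ≤ i → w i = i) {a : ℕ} (ha : a < N) : w a < N := by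
  by_contra! hc
  have := w.injective (h _ hc)
  omega

theorem mul_swap_succ_fixed {i : ℕ} (h : ∀ j, N ≤ j → w j = j) (hi : i + 1 < N) :
    ∀ j, N ≤ j → (w * Equiv.swap i (i + 1)) j = j := fun j hj => by
  rw [mul_swap_succ_apply_of_ne _ (by omega) (by omega), h j hj]

theorem grothendieckAux_succ (hfix : ∀ i, N ≤ i → w i = i) :
    grothendieckAux (N + 1) w = grothendieckAux N w := by
  induction w using nonInv_induction (N := N) with
  | h w ih =>
  by_cases hasc : ∃ i, i + 1 < N ∧ w i < w (i + 1)
  · obtain ⟨i, hi, hw⟩ := hasc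
    rw [ascentRecursion _ _ i hi hw, ascentRecursion _ _ i (by omega) hw,
      ih i hi hw (mul_swap_succ_fixed hfix hi)]
  · have hdesc : ∀ i, i + 1 < N → w (i + 1) < w i := fun i hi =>
      succ_lt_of_not_lt fun h => hasc ⟨i, hi, h⟩
    rw [grothendieckAux_of_no_ascent hdesc, grothendieckAux_succ_of_strictAntiOn le_rfl,
      Finset.Ico_self]
    · intro a ha haN
      rw [hfix N le_rfl]
      exact apply_lt_of_fixed hfix (by omega)
    · rw [Set.Iic_sdiff_right]
      exact strictAntiOn_of_add_one_lt Set.ordConnected_Iio fun a _ _ ha => hdesc a ha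

theorem grothendieck_eq {w : SInf} (h : ∀ i, N ≤ i → w.1 i = i) :
    grothendieck w = grothendieckAux N w.1 := by
  classical
  have hspec := Nat.find_spec w.2
  induction N, Nat.find_min' w.2 h using Nat.le_induction with
  | base => rfl
  | succ N hle ih =>
    have hN : ∀ i, N ≤ i → w.1 i = i := fun i hi => hspec i (hle.trans hi)
    rw [ih hN, grothendieckAux_succ hN]

end Stability

/-! ### Grothendieck polynomials of `S_∞` -/

section SInf

variable {i : ℕ} {w : SInf}

/-- The element `w s_i` of `S_∞`. -/
def mulSwap (i : ℕ) (w : SInf) : SInf :=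
  ⟨w.1 * Equiv.swap i (i + 1), by
    obtain ⟨N, hN⟩ := w.2
    exact ⟨N + i + 2, mul_swap_succ_fixed (fun j hj => hN j (by omega)) (by omega)⟩⟩

theorem mulSwap_mulSwap (i : ℕ) (w : SInf) : mulSwap i (mulSwap i w) = w :=
  Subtype.ext <| Equiv.mul_swap_mul_self i (i + 1) w.1

theorem mulSwap_apply_succ_lt_iff :
    (mulSwap i w).1 (i + 1) < (mulSwap i w).1 i ↔ w.1 i < w.1 (i + 1) := by
  rw [mulSwap, mul_swap_succ_apply_left, mul_swap_succ_apply_right]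

theorem mulSwap_apply_lt_iff :
    (mulSwap i w).1 i < (mulSwap i w).1 (i + 1) ↔ w.1 (i + 1) < w.1 i := by
  rw [mulSwap, mul_swap_succ_apply_left, mul_swap_succ_apply_right]

theorem grothendieck_of_lt (h : w.1 i < w.1 (i + 1)) :
    grothendieck w = isobaric i (grothendieck (mulSwap i w)) := by
  obtain ⟨N, hN⟩ := w.2
  have hfix : ∀ j, N + i + 2 ≤ j → w.1 j = j := fun j hj => hN j (by omega)
  rw [grothendieck_eq hfix, grothendieck_eq (mul_swap_succ_fixed hfix (i := i) (by omega)),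
    ascentRecursion _ _ i (by omega) h]
  rfl

theorem isobaric_grothendieck_of_lt (h : w.1 i < w.1 (i + 1)) :
    isobaric i (grothendieck w) = grothendieck w := by
  rw [grothendieck_of_lt h, isobaric_isobaric]

theorem isobaric_grothendieck_of_gt (h : w.1 (i + 1) < w.1 i) :
    isobaric i (grothendieck w) = grothendieck (mulSwap i w) := by
  rw [grothendieck_of_lt (mulSwap_apply_lt_iff.mpr h), mulSwap_mulSwap]

theorem swapVars_grothendieck_of_lt (h : w.1 i < w.1 (i + 1)) :
    swapVars i (grothendieck w) = grothendieck w := by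
  rw [grothendieck_of_lt h, swapVars_isobaric]

/-- The identity of `S_∞`. -/
def oneSInf : SInf := ⟨1, 0, fun _ _ => rfl⟩

theorem grothendieck_one : grothendieck oneSInf = 1 := by
  rw [grothendieck_eq (N := 0) fun _ _ => rfl, grothendieckAux_of_no_ascent (by omega), stair_empty,
    Finset.prod_range_zero]

theorem lt_of_mem_vars_of_swapVars_eq {m j : ℕ} {f : MvPolynomial ℕ ℤ}
    (hf : ∀ k, m ≤ k → swapVars k f = f) (hj : j ∈ f.vars) : j < m := by
  by_contra! hmj
  have hsucc : ∀ k, m ≤ k → k ∈ f.vars → k + 1 ∈ f.vars := fun k hk hkf => by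
    rw [← hf k hk] at hkf
    obtain ⟨l, hl, hlk⟩ := mem_vars_rename _ _ hkf
    rwa [Equiv.swap_apply_eq_iff.mp hlk, Equiv.swap_apply_left] at hl
  have hall : ∀ k ≥ j, k ∈ f.vars := fun k hk => by
    induction k, hk using Nat.le_induction with
    | base => exact hj
    | succ k hk ih => exact hsucc k (hmj.trans hk) ih
  exact (Set.Ici_infinite j) (f.vars.finite_toSet.subset hall)

theorem lt_of_mem_vars_grothendieck {n j : ℕ} (h : ∀ i, n ≤ i → w.1 i = i)
    (hj : j ∈ (grothendieck w).vars) : j + 1 < n := by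
  refine Nat.add_lt_of_lt_sub (lt_of_mem_vars_of_swapVars_eq (fun k hk => ?_) hj)
  refine swapVars_grothendieck_of_lt ?_
  rw [h (k + 1) (by omega)]
  exact apply_lt_of_fixed (fun i hi => h i (by omega)) (Nat.lt_succ_self k)

end SInf

/-! ### Constant terms -/

section ConstantTerm

variable {i k : ℕ}

/-- The ideal of polynomials without constant term. Its powers measure the lowest degree of a
polynomial. -/
noncomputable abbrev augmentation : Ideal (MvPolynomial ℕ ℤ) := RingHom.ker constantCoeff

theorem divDiff_mem_pow {f : MvPolynomial ℕ ℤ} (hf : f ∈ augmentation ^ (k + 1)) :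
    divDiff i f ∈ augmentation ^ k := by
  induction k generalizing f with
  | zero => simp only [pow_zero, Ideal.one_eq_top, Submodule.mem_top]
  | succ k ih =>
    rw [pow_succ'] at hf
    induction hf using Submodule.mul_induction_on' with
    | mem_mul_mem a ha b hb =>
      have hswap : swapVars i a ∈ augmentation := by
        rwa [RingHom.mem_ker, constantCoeff_rename]
      rw [divDiff_mul]
      refine add_mem (Ideal.mul_mem_left _ _ hb) ?_
      rw [pow_succ']
      exact Ideal.mul_mem_mul hswap (ih hb)
    | add a _ b _ ha hb =>
      rw [divDiff_add]
      exact add_mem ha hb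

theorem isobaric_mem_pow {f : MvPolynomial ℕ ℤ} (hf : f ∈ augmentation ^ (k + 1)) :
    isobaric i f ∈ augmentation ^ k :=
  divDiff_mem_pow (Ideal.mul_mem_left _ _ hf)

theorem card_nonInv_one (N : ℕ) :
    (nonInv N 1).card = ∑ i ∈ Finset.range N, (N - 1 - i) := by
  have hpairs : nonInv N 1 = (Finset.range N ×ˢ Finset.range N).filter fun p => p.1 < p.2 :=
    Finset.filter_congr fun p _ => and_self_iff
  rw [hpairs, Finset.card_filter, Finset.sum_product]
  refine Finset.sum_congr rfl fun i _ => ?_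
  have hIoo : (Finset.range N).filter (i < ·) = Finset.Ioo i N := by
    ext j
    simp only [Finset.mem_filter, Finset.mem_range, Finset.mem_Ioo, and_comm]
  rw [← Finset.card_filter, hIoo, Nat.card_Ioo]
  omega

theorem nonInv_subset_nonInv_one (N : ℕ) (w : Equiv.Perm ℕ) : nonInv N w ⊆ nonInv N 1 := by
  intro p hp
  simp only [nonInv, Finset.mem_filter] at hp ⊢
  exact ⟨hp.1, hp.2.1, hp.2.1⟩

theorem grothendieckAux_mem_pow (N : ℕ) (w : Equiv.Perm ℕ) :
    grothendieckAux N w ∈ augmentation ^ ((nonInv N 1).card - (nonInv N w).card) := by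
  induction w using nonInv_induction (N := N) with
  | h w ih =>
  by_cases hasc : ∃ i, i + 1 < N ∧ w i < w (i + 1)
  · obtain ⟨i, hi, hw⟩ := hasc
    have hlt := card_nonInv_lt hi hw
    rw [ascentRecursion _ _ i hi hw]
    rcases Nat.eq_zero_or_pos ((nonInv N 1).card - (nonInv N w).card) with h0 | hpos
    · simp only [h0, pow_zero, Ideal.one_eq_top, Submodule.mem_top]
    · exact isobaric_mem_pow (Ideal.pow_le_pow_right (by omega) (ih i hi hw))
  · rw [grothendieckAux, dif_neg hasc, card_nonInv_one]
    refine Ideal.pow_le_pow_right (Nat.sub_le _ _) ?_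
    rw [← Finset.prod_pow_eq_pow_sum]
    exact Ideal.prod_mem_prod fun i _ => Ideal.pow_mem_pow (constantCoeff_X _ i) _

theorem constantCoeff_grothendieck_of_gt {w : SInf} (h : w.1 (i + 1) < w.1 i) :
    constantCoeff (grothendieck w) = 0 := by
  obtain ⟨N, hN⟩ := w.2
  have hmem : (i, i + 1) ∈ nonInv (N + i + 2) 1 :=
    Finset.mem_filter.mpr ⟨Finset.mem_product.mpr ⟨Finset.mem_range.mpr (by omega),
      Finset.mem_range.mpr (by omega)⟩, Nat.lt_succ_self i, Nat.lt_succ_self i⟩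
  have hlt : (nonInv (N + i + 2) w.1).card < (nonInv (N + i + 2) 1).card :=
    Finset.card_lt_card <| (Finset.ssubset_iff_of_subset (nonInv_subset_nonInv_one _ _)).mpr
      ⟨_, hmem, fun hmem' => h.asymm (Finset.mem_filter.mp hmem').2.2⟩
  rw [grothendieck_eq (N := N + i + 2) fun j hj => hN j (by omega), ← RingHom.mem_ker]
  exact Ideal.pow_le_self (Nat.sub_pos_of_lt hlt).ne' (grothendieckAux_mem_pow _ _)

theorem exists_descent {w : SInf} (hw : w ≠ oneSInf) : ∃ i, w.1 (i + 1) < w.1 i := by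
  by_contra! h
  have hmono : StrictMono w.1 := strictMono_nat_of_lt_succ fun i =>
    (h i).lt_of_ne (w.1.injective.ne (Nat.succ_ne_self i).symm)
  have hrefl := Subsingleton.elim (hmono.orderIsoOfSurjective w.1 w.1.surjective) (OrderIso.refl ℕ)
  exact hw (Subtype.ext (Equiv.ext fun i => DFunLike.congr_fun hrefl i))

theorem constantCoeff_grothendieck [DecidableEq SInf] (w : SInf) :
    constantCoeff (grothendieck w) = if w = oneSInf then 1 else 0 := by
  split_ifs with h
  · rw [h, grothendieck_one, map_one]
  · obtain ⟨i, hi⟩ := exists_descent h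
    exact constantCoeff_grothendieck_of_gt hi

end ConstantTerm

/-! ### Demazure operators on free modules -/

section Demazure

variable {G ι : Type*}

open Classical in
/-- The Demazure action of an involution `σ` (multiplication by a simple reflection) on a set of
permutations: remove the descent if there is one. `D w` says that `w` has the descent. -/
noncomputable def removeDescent (σ : G → G) (D : G → Prop) (w : G) : G :=
  if D w then σ w else w

theorem removeDescent_eq_iff {σ : G → G} {D : G → Prop} (hσ : Function.Involutive σ)
    (hD : ∀ w, D (σ w) ↔ ¬ D w) {v w : G} (hw : D w) :
    removeDescent σ D v = σ w ↔ v = w ∨ v = σ w := by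
  have hσw : ¬ D (σ w) := fun h => (hD w).mp h hw
  rw [removeDescent]
  split_ifs with hv
  · rw [hσ.injective.eq_iff, iff_self_or]
    rintro rfl
    exact absurd hv hσw
  · rw [iff_or_self]
    rintro rfl
    exact absurd hw hv

theorem mapDomain_removeDescent_apply {σ : G → G} {D : G → Prop} (hσ : Function.Involutive σ)
    (hD : ∀ w, D (σ w) ↔ ¬ D w) {w : G} (hw : D w) (c : G →₀ ℤ) :
    Finsupp.mapDomain (removeDescent σ D) c (σ w) = c w + c (σ w) := by
  classical
  have hne : w ≠ σ w := fun h => (hD w).mp (h ▸ hw) hw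
  induction c using Finsupp.induction_linear with
  | zero => simp only [Finsupp.mapDomain_zero, Finsupp.zero_apply, add_zero]
  | add f g hf hg =>
    rw [Finsupp.mapDomain_add, Finsupp.add_apply, hf, hg, Finsupp.add_apply, Finsupp.add_apply]
    ring
  | single v a =>
    simp only [Finsupp.mapDomain_single, Finsupp.single_apply, removeDescent_eq_iff hσ hD hw]
    rcases eq_or_ne v w with rfl | hv
    · simp only [true_or, if_true, if_neg hne, add_zero]
    · simp only [hv, false_or, if_false, zero_add]

/-- The coefficient of `w` in `c` is controlled by the coefficients of `σ i w` in `c` and in its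
image, so that the vanishing of coefficients propagates from `e` to all of `G`. -/
theorem eq_zero_of_stable {σ : ι → G → G} {D : ι → G → Prop} {e : G}
    (hσ : ∀ i, Function.Involutive (σ i)) (hD : ∀ i w, D i (σ i w) ↔ ¬ D i w)
    (hind : ∀ P : G → Prop, P e → (∀ w i, D i w → P (σ i w) → P w) → ∀ w, P w)
    {K : Set (G →₀ ℤ)} (hK : ∀ i, ∀ c ∈ K, Finsupp.mapDomain (removeDescent (σ i) (D i)) c ∈ K)
    (he : ∀ c ∈ K, c e = 0) {c : G →₀ ℤ} (hc : c ∈ K) : c = 0 := by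
  suffices hcoeff : ∀ w, ∀ c ∈ K, c w = 0 from Finsupp.ext fun w => hcoeff w c hc
  refine hind _ he fun w i hw ih c hc => ?_
  have hsum := mapDomain_removeDescent_apply (hσ i) (hD i) hw c
  rwa [ih _ (hK i c hc), ih c hc, add_zero, eq_comm] at hsum

theorem sInf_induction {P : SInf → Prop} (one : P oneSInf)
    (step : ∀ w i, w.1 (i + 1) < w.1 i → P (mulSwap i w) → P w) (w : SInf) : P w := by
  obtain ⟨N, hN⟩ := w.2
  induction hk : (nonInv N 1).card - (nonInv N w.1).card
    using Nat.strong_induction_on generalizing w with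
  | _ k ih =>
  rcases eq_or_ne w oneSInf with rfl | hw
  · exact one
  obtain ⟨i, hi⟩ := exists_descent hw
  have hiN : i + 1 < N := by
    by_contra! hc
    refine hi.asymm ?_
    rw [hN (i + 1) hc]
    exact apply_lt_of_fixed (fun j hj => hN j (by omega)) (Nat.lt_succ_self i)
  refine step w i hi (ih _ ?_ (mulSwap i w) (mul_swap_succ_fixed hN hiN) rfl)
  have hlt := card_nonInv_lt hiN (mulSwap_apply_lt_iff.mpr hi)
  have hle := Finset.card_le_card (nonInv_subset_nonInv_one N (mulSwap i w).1)
  rw [show (mulSwap i w).1 * Equiv.swap i (i + 1) = w.1 from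
    congrArg Subtype.val (mulSwap_mulSwap i w)] at hlt
  omega

/-- The Demazure action of `s_i` on `S_∞` from the right. -/
noncomputable abbrev demazure (i : ℕ) : SInf → SInf :=
  removeDescent (mulSwap i) fun w => w.1 (i + 1) < w.1 i

theorem isobaric_grothendieck (i : ℕ) (w : SInf) :
    isobaric i (grothendieck w) = grothendieck (demazure i w) := by
  rw [demazure, removeDescent]
  split_ifs with h
  · exact isobaric_grothendieck_of_gt h
  · exact isobaric_grothendieck_of_lt
      ((not_lt.mp h).lt_of_ne (w.1.injective.ne (Nat.succ_ne_self i).symm))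

end Demazure

/-! ### The basis of Grothendieck polynomials -/

section Basis

theorem isobaric_linearCombination (i : ℕ) (c : SInf →₀ ℤ) :
    isobaric i (Finsupp.linearCombination ℤ grothendieck c) =
      Finsupp.linearCombination ℤ grothendieck (Finsupp.mapDomain (demazure i) c) := by
  rw [Finsupp.linearCombination_mapDomain, ← isobaricLin_apply, Finsupp.apply_linearCombination]
  congr 2
  exact funext (isobaric_grothendieck i)

theorem constantCoeff_linearCombination (c : SInf →₀ ℤ) :
    constantCoeff (Finsupp.linearCombination ℤ grothendieck c) = c oneSInf := by
  classical
  simp only [Finsupp.linearCombination_apply, map_finsuppSum, constantCoeff_smul,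
    constantCoeff_grothendieck, smul_eq_mul, mul_ite, mul_one, mul_zero, Finsupp.sum_ite_self_eq']

theorem linearIndependent_grothendieck : LinearIndependent ℤ grothendieck := by
  rw [linearIndependent_iff]
  intro c hc
  refine eq_zero_of_stable (K := {c | Finsupp.linearCombination ℤ grothendieck c = 0})
    mulSwap_mulSwap (fun i w => ?_) (fun P => sInf_induction) (fun i c hc => ?_) (fun c hc => ?_) hc
  · rw [mulSwap_apply_succ_lt_iff, not_lt, (w.1.injective.ne (Nat.succ_ne_self i)).symm.le_iff_lt]
  · rw [Set.mem_ofPred_eq] at hc ⊢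
    rw [← isobaric_linearCombination, hc, ← isobaricLin_apply, map_zero]
  · rw [Set.mem_ofPred_eq] at hc
    rw [← constantCoeff_linearCombination, hc, map_zero]

/-- The span of all Grothendieck polynomials, which turns out to be everything. -/
noncomputable abbrev grothendieckSpan : Submodule ℤ (MvPolynomial ℕ ℤ) :=
  Submodule.span ℤ (Set.range grothendieck)

theorem grothendieck_mem_span (w : SInf) : grothendieck w ∈ grothendieckSpan :=
  Submodule.subset_span (Set.mem_range_self w)

theorem grothendieckAux_mem_span {N : ℕ} {w : Equiv.Perm ℕ} (hw : ∀ i, N ≤ i → w i = i) :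
    grothendieckAux N w ∈ grothendieckSpan := by
  have := grothendieck_mem_span ⟨w, N, hw⟩
  rwa [grothendieck_eq hw] at this

theorem isobaric_mem_span (i : ℕ) {f : MvPolynomial ℕ ℤ} (hf : f ∈ grothendieckSpan) :
    isobaric i f ∈ grothendieckSpan := by
  refine (Submodule.map_span_le (isobaricLin i) _ _).mpr ?_ (Submodule.mem_map_of_mem hf)
  rintro _ ⟨w, rfl⟩
  rw [isobaricLin_apply, isobaric_grothendieck]
  exact grothendieck_mem_span _

theorem exists_no_ascent (N : ℕ) :
    ∃ w : Equiv.Perm ℕ, (∀ i, N ≤ i → w i = i) ∧ ∀ i, i + 1 < N → w (i + 1) < w i := by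
  suffices ∀ w : Equiv.Perm ℕ, (∀ i, N ≤ i → w i = i) →
      ∃ v : Equiv.Perm ℕ, (∀ i, N ≤ i → v i = i) ∧ ∀ i, i + 1 < N → v (i + 1) < v i from
    this 1 fun _ _ => rfl
  refine nonInv_induction (N := N) fun w ih hw => ?_
  by_cases hasc : ∃ i, i + 1 < N ∧ w i < w (i + 1)
  · obtain ⟨i, hi, hlt⟩ := hasc
    exact ih i hi hlt (mul_swap_succ_fixed hw hi)
  · exact ⟨w, hw, fun i hi => succ_lt_of_not_lt fun h => hasc ⟨i, hi, h⟩⟩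

theorem stair_Ico_mem_span {N k : ℕ} (hk : k ≤ N) :
    stair N (Finset.Ico k N) ∈ grothendieckSpan := by
  induction k with
  | zero =>
    obtain ⟨w, hw, hdesc⟩ := exists_no_ascent (N + 1)
    have hmem := grothendieckAux_mem_span hw
    rwa [grothendieckAux_of_no_ascent hdesc, stair_empty, ← stair_range,
      Finset.range_eq_Ico] at hmem
  | succ k ih =>
    have hmem := isobaric_mem_span k (ih (by omega))
    rwa [← Finset.insert_Ico_succ_left_eq_Ico hk,
      isobaric_stair_insert hk (by simp) (by simp [Finset.mem_Ico])] at hmem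

theorem stair_insert_Ico_mem_span {N p k : ℕ} (hpk : p < k) (hk : k ≤ N) :
    stair N (insert p (Finset.Ico k N)) ∈ grothendieckSpan := by
  induction k, hpk using Nat.le_induction with
  | base =>
    rw [Nat.succ_eq_add_one, Finset.insert_Ico_add_one_left_eq_Ico hk]
    exact stair_Ico_mem_span (by omega)
  | succ k hpk ih =>
    have hmem := isobaric_mem_span k (ih (by omega))
    rwa [← Finset.insert_Ico_succ_left_eq_Ico hk, Finset.insert_comm, isobaric_stair_insert hk]
      at hmem
    · simp only [Finset.mem_insert, Finset.mem_Ico, Nat.succ_eq_succ]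
      omega
    · simp only [Finset.mem_insert, Finset.mem_Ico, Nat.succ_eq_succ]
      omega

theorem one_sub_X_mul_grothendieckAux_mem_span {N : ℕ} {w : Equiv.Perm ℕ}
    (hw : ∀ i, N ≤ i → w i = i) {p : ℕ} (hp : p < N) :
    (1 - X p) * grothendieckAux N w ∈ grothendieckSpan := by
  induction w using nonInv_induction (N := N) generalizing p with
  | h w ih =>
  by_cases hasc : ∃ i, i + 1 < N ∧ w i < w (i + 1)
  · obtain ⟨i, hi, hlt⟩ := hasc
    replace ih {p} := ih i hi hlt (mul_swap_succ_fixed hw hi) (p := p)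
    rw [ascentRecursion _ _ i hi hlt]
    set g := grothendieckAux N (w * Equiv.swap i (i + 1))
    rcases eq_or_ne p i with rfl | hpi
    · rw [← sub_eq_of_eq_add' (isobaric_mul_right p g)]
      exact sub_mem (isobaric_mem_span _ (ih hi)) (ih hi)
    rcases eq_or_ne p (i + 1) with rfl | hpi'
    · have hsum : (1 - X (i + 1)) * isobaric i g =
          isobaric i ((1 - X i) * g) + (1 - X (i + 1)) * g := by
        rw [isobaric_mul_left]
        ring
      rw [hsum]
      exact add_mem (isobaric_mem_span _ (ih (by omega))) (ih hi)
    · rw [← isobaric_mul_of_swapVars_eq (swapVars_one_sub_X_of_ne hpi hpi')]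
      exact isobaric_mem_span _ (ih hp)
  · rw [grothendieckAux, dif_neg hasc, ← stair_empty, sub_mul, one_mul,
      ← stair_insert hp.le (Finset.notMem_empty p), ← Finset.Ico_self N]
    exact sub_mem (stair_Ico_mem_span le_rfl) (stair_insert_Ico_mem_span hp le_rfl)

theorem X_mul_mem_span (p : ℕ) {f : MvPolynomial ℕ ℤ} (hf : f ∈ grothendieckSpan) :
    X p * f ∈ grothendieckSpan := by
  refine (Submodule.map_span_le (LinearMap.mulLeft ℤ (X p)) _ _).mpr ?_
    (Submodule.mem_map_of_mem hf)
  rintro _ ⟨w, rfl⟩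
  obtain ⟨N, hN⟩ := w.2
  have hfix : ∀ j, N + p + 1 ≤ j → w.1 j = j := fun j hj => hN j (by omega)
  have hmem := one_sub_X_mul_grothendieckAux_mem_span hfix (p := p) (by omega)
  rw [← grothendieck_eq hfix, sub_mul, one_mul] at hmem
  exact (Submodule.sub_mem_iff_right _ (grothendieck_mem_span w)).mp hmem

theorem grothendieckSpan_eq_top : grothendieckSpan = ⊤ := by
  refine Submodule.eq_top_iff'.mpr fun f => ?_
  induction f using MvPolynomial.induction_on with
  | C a =>
    have hmem := grothendieckSpan.smul_mem a (grothendieck_mem_span oneSInf)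
    rwa [grothendieck_one, smul_eq_C_mul, mul_one] at hmem
  | add p q hp hq => exact add_mem hp hq
  | mul_X p i hp =>
    rw [mul_comm]
    exact X_mul_mem_span i hp

/-- The Grothendieck polynomials, as a basis of the polynomial ring. -/
noncomputable def grothendieckBasis : Module.Basis SInf ℤ (MvPolynomial ℕ ℤ) :=
  Module.Basis.mk linearIndependent_grothendieck grothendieckSpan_eq_top.ge

theorem grothendieckBasis_apply (w : SInf) : grothendieckBasis w = grothendieck w :=
  Module.Basis.mk_apply _ _ w

theorem grothendieckBasis_repr_grothendieck (w : SInf) :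
    grothendieckBasis.repr (grothendieck w) = Finsupp.single w 1 := by
  rw [← grothendieckBasis_apply, Module.Basis.repr_self]

theorem linearCombination_grothendieckBasis_repr (f : MvPolynomial ℕ ℤ) :
    Finsupp.linearCombination ℤ grothendieck (grothendieckBasis.repr f) = f := by
  rw [← funext grothendieckBasis_apply, Module.Basis.linearCombination_repr]

theorem eq_grothendieckBasis_repr_iff {f : MvPolynomial ℕ ℤ} {c : SInf →₀ ℤ} :
    f = c.sum (fun w a => a • grothendieck w) ↔ c = grothendieckBasis.repr f := by
  rw [← Finsupp.linearCombination_apply, ← funext grothendieckBasis_apply,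
    ← Module.Basis.repr_symm_apply, LinearEquiv.eq_symm_apply, eq_comm]

theorem grothendieckBasis_repr_isobaric (i : ℕ) (f : MvPolynomial ℕ ℤ) :
    grothendieckBasis.repr (isobaric i f) =
      Finsupp.mapDomain (demazure i) (grothendieckBasis.repr f) := by
  rw [eq_comm, ← eq_grothendieckBasis_repr_iff, ← Finsupp.linearCombination_apply,
    ← isobaric_linearCombination, linearCombination_grothendieckBasis_repr]

theorem grothendieckBasis_repr_one (f : MvPolynomial ℕ ℤ) :
    grothendieckBasis.repr f oneSInf = constantCoeff f := by
  rw [← constantCoeff_linearCombination, linearCombination_grothendieckBasis_repr]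

end Basis

/-! ### Dunkl elements of the quadratic algebra -/

section QuadAlg

variable {n : ℕ}

theorem bracket_self (i : Fin n) : bracket i i = 0 :=
  dif_neg (not_not.mpr rfl)

theorem bracket_of_ne {i j : Fin n} (h : i ≠ j) :
    bracket i j = RingQuot.mkAlgHom ℤ (Rel n) (freeGen i j h) :=
  dif_pos h

theorem bracket_add_symm (i j : Fin n) : bracket i j + bracket j i = 0 := by
  rcases eq_or_ne i j with rfl | h
  · rw [bracket_self, add_zero]
  · have hrel := RingQuot.mkAlgHom_rel ℤ (Rel.antisymm i j h)
    rwa [map_add, map_zero, ← bracket_of_ne, ← bracket_of_ne] at hrel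

theorem bracket_mul_self (i j : Fin n) : bracket i j * bracket i j = 0 := by
  rcases eq_or_ne i j with rfl | h
  · rw [bracket_self, zero_mul]
  · have hrel := RingQuot.mkAlgHom_rel ℤ (Rel.square i j h)
    rwa [map_mul, map_zero, ← bracket_of_ne] at hrel

theorem bracket_symm_mul_bracket_symm (i j k l : Fin n) :
    bracket j i * bracket l k = bracket i j * bracket k l :=
  calc bracket j i * bracket l k
      = bracket j i * bracket l k + bracket i j * (bracket k l + bracket l k) := by
        rw [bracket_add_symm, mul_zero, add_zero]
    _ = (bracket i j + bracket j i) * bracket l k + bracket i j * bracket k l := by noncomm_ring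
    _ = bracket i j * bracket k l := by rw [bracket_add_symm, zero_mul, zero_add]

theorem bracket_mul_bracket_symm (i j : Fin n) : bracket i j * bracket j i = 0 :=
  calc bracket i j * bracket j i
      = bracket i j * bracket i j + bracket i j * bracket j i := by
        rw [bracket_mul_self, zero_add]
    _ = 0 := by rw [← mul_add, bracket_add_symm, mul_zero]

theorem bracket_triangle (i j k : Fin n) :
    bracket i j * bracket j k + bracket j k * bracket k i + bracket k i * bracket i j = 0 := by
  by_cases h : i ≠ j ∧ j ≠ k ∧ k ≠ i
  · have hrel := RingQuot.mkAlgHom_rel ℤ (Rel.triangle i j k h.1 h.2.1 h.2.2)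
    rwa [map_add, map_add, map_mul, map_mul, map_mul, map_zero, ← bracket_of_ne, ← bracket_of_ne,
      ← bracket_of_ne] at hrel
  · obtain rfl | rfl | rfl : i = j ∨ j = k ∨ k = i := by tauto
    all_goals
      simp only [bracket_self, bracket_mul_bracket_symm, mul_zero, zero_mul, add_zero]

theorem bracket_mul_bracket (i j k : Fin n) :
    bracket i j * bracket j k = bracket j k * bracket i k + bracket i k * bracket i j :=
  calc bracket i j * bracket j k
      = bracket i j * bracket j k + bracket j k * (bracket i k + bracket k i)
          + (bracket i k + bracket k i) * bracket i j := by
        rw [bracket_add_symm, mul_zero, zero_mul, add_zero, add_zero]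
    _ = bracket i j * bracket j k + bracket j k * bracket k i + bracket k i * bracket i j
          + (bracket j k * bracket i k + bracket i k * bracket i j) := by noncomm_ring
    _ = bracket j k * bracket i k + bracket i k * bracket i j := by
        rw [bracket_triangle, zero_add]

theorem bracket_commute {i j k l : Fin n} (hik : i ≠ k) (hil : i ≠ l) (hjk : j ≠ k)
    (hjl : j ≠ l) : Commute (bracket i j) (bracket k l) := by
  rcases eq_or_ne i j with rfl | hij
  · rw [bracket_self]
    exact Commute.zero_left _
  rcases eq_or_ne k l with rfl | hkl
  · rw [bracket_self]
    exact Commute.zero_right _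
  have hrel := RingQuot.mkAlgHom_rel ℤ (Rel.comm i j k l hij hkl hik hil hjk hjl)
  rwa [map_mul, map_mul, ← bracket_of_ne, ← bracket_of_ne] at hrel

theorem one_add_bracket_mul_symm (i j : Fin n) :
    (1 + bracket i j) * (1 + bracket j i) = 1 := by
  rw [mul_add, mul_one, add_mul, one_mul, bracket_mul_bracket_symm, add_zero, add_assoc,
    bracket_add_symm, add_zero]

theorem one_add_mul_one_add_mul_one_add {S : Type*} [Semiring S] {x y b : S} (hb : b * b = 0)
    (hbx : b * x = x * y + y * b) (hxb : x * b = b * y + y * x) :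
    (1 + x) * (1 + y) * (1 + b) = (1 + b) * (1 + y) * (1 + x) := by
  have hcubic : x * y * b = b * y * x := by
    calc x * y * b = (x * y + y * b) * b := by rw [add_mul, mul_assoc y, hb, mul_zero, add_zero]
      _ = b * (b * y + y * x) := by rw [← hbx, mul_assoc, hxb]
      _ = b * y * x := by rw [mul_add, ← mul_assoc, hb, zero_mul, zero_add, mul_assoc]
  calc (1 + x) * (1 + y) * (1 + b)
      = 1 + x + y + b + (x * y + y * b) + x * b + x * y * b := by noncomm_ring
    _ = 1 + x + y + b + b * x + (b * y + y * x) + b * y * x := by rw [hbx, hxb, hcubic]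
    _ = (1 + b) * (1 + y) * (1 + x) := by noncomm_ring

theorem bracket_yangBaxter (i j p : Fin n) :
    (1 + bracket i p) * (1 + bracket j p) * (1 + bracket j i) =
      (1 + bracket j i) * (1 + bracket j p) * (1 + bracket i p) := by
  refine one_add_mul_one_add_mul_one_add (bracket_mul_self j i) (bracket_mul_bracket j i p) ?_
  rw [← bracket_symm_mul_bracket_symm, bracket_mul_bracket, ← bracket_symm_mul_bracket_symm,
    ← bracket_symm_mul_bracket_symm p j]

/-- The indices `p-1, …, 1, n, …, p+1`, in the order in which they occur in `κ_p`. -/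
def dunklOrder (p : Fin n) : List (Fin n) :=
  ((List.finRange n).filter (· < p)).reverse ++ ((List.finRange n).filter (p < ·)).reverse

theorem dunklOrder_eq {p : Fin n} {l l' : List (Fin n)} (h : List.finRange n = l ++ p :: l') :
    dunklOrder p = l.reverse ++ l'.reverse := by
  have hlt := List.pairwise_lt_finRange n
  rw [h, List.pairwise_append, List.pairwise_cons] at hlt
  obtain ⟨-, ⟨hp', -⟩, hp⟩ := hlt
  have hl (a) (ha : a ∈ l) : a < p := hp a ha p List.mem_cons_self
  have filter_lt : (l ++ p :: l').filter (· < p) = l := by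
    rw [List.filter_append, List.filter_cons_of_neg (by simp),
      List.filter_eq_self.mpr fun a ha => by simpa using hl a ha,
      List.filter_eq_nil_iff.mpr fun a ha => by simpa using (hp' a ha).le, List.append_nil]
  have filter_gt : (l ++ p :: l').filter (p < ·) = l' := by
    rw [List.filter_append, List.filter_cons_of_neg (by simp),
      List.filter_eq_nil_iff.mpr fun a ha => by simpa using (hl a ha).le,
      List.filter_eq_self.mpr fun a ha => by simpa using hp' a ha, List.nil_append]
  rw [dunklOrder, h, filter_lt, filter_gt]

theorem ne_of_mem_dunklOrder {a p : Fin n} (ha : a ∈ dunklOrder p) : a ≠ p := by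
  simp only [dunklOrder, List.mem_append, List.mem_reverse, List.mem_filter,
    decide_eq_true_eq] at ha
  exact ha.elim (fun h => h.2.ne) fun h => h.2.ne'

theorem nodup_dunklOrder (p : Fin n) : (dunklOrder p).Nodup := by
  have hnd := List.nodup_finRange n
  refine (List.nodup_reverse.mpr (hnd.filter _)).append (List.nodup_reverse.mpr (hnd.filter _)) ?_
  intro a hlt hgt
  simp only [List.mem_reverse, List.mem_filter, decide_eq_true_eq] at hlt hgt
  exact hlt.2.asymm hgt.2

theorem exists_finRange_eq {i j : Fin n} (hij : i ⋖ j) :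
    ∃ l l', List.finRange n = l ++ i :: j :: l' := by
  have hj : j.val = i.val + 1 := (Order.covBy_iff_add_one_eq.mp (Fin.covBy_iff.mp hij)).symm
  have hlt : i.val + 1 < n := hj ▸ j.isLt
  refine ⟨(List.finRange n).take i, (List.finRange n).drop (i + 1 + 1), ?_⟩
  conv_lhs => rw [← List.take_append_drop i (List.finRange n)]
  rw [List.drop_eq_getElem_cons (by simp), List.drop_eq_getElem_cons (by simpa using hlt)]
  simp [Fin.ext_iff, hj]

theorem exists_dunklOrder_of_covBy {i j : Fin n} (hij : i ⋖ j) :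
    ∃ m, dunklOrder i = m ++ [j] ∧ dunklOrder j = i :: m := by
  obtain ⟨l, l', h⟩ := exists_finRange_eq hij
  have h' : List.finRange n = (l ++ [i]) ++ j :: l' := by
    rw [h, List.append_assoc, List.singleton_append]
  refine ⟨l.reverse ++ l'.reverse, ?_, ?_⟩
  · rw [dunklOrder_eq h, List.reverse_cons, List.append_assoc]
  · rw [dunklOrder_eq h', List.reverse_concat, List.cons_append]

theorem exists_dunklOrder_of_ne {i j p : Fin n} (hij : i ⋖ j) (hi : p ≠ i) (hj : p ≠ j) :
    ∃ m m', dunklOrder p = m ++ j :: i :: m' := by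
  obtain ⟨l, l', h⟩ := exists_finRange_eq hij
  have hp := List.mem_finRange p
  simp only [h, List.mem_append, List.mem_cons, hi, hj, false_or] at hp
  rcases hp with hp | hp
  · obtain ⟨a, b, rfl⟩ := List.append_of_mem hp
    refine ⟨a.reverse ++ l'.reverse, b.reverse, ?_⟩
    rw [dunklOrder_eq (l := a) (l' := b ++ i :: j :: l') (by simp [h])]
    simp
  · obtain ⟨a, b, rfl⟩ := List.append_of_mem hp
    refine ⟨a.reverse, l.reverse ++ b.reverse, ?_⟩
    rw [dunklOrder_eq (l := l ++ i :: j :: a) (l' := b) (by simp [h])]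
    simp

/-- The product `(1 + [a₁ p]) (1 + [a₂ p]) ⋯` over a list of indices `a₁, a₂, …`. -/
noncomputable def dunklProd (p : Fin n) (l : List (Fin n)) : QuadAlg n :=
  (l.map fun a => 1 + bracket a p).prod

theorem one_sub_kappa (p : Fin n) : 1 - kappa p = dunklProd p (dunklOrder p) :=
  sub_sub_cancel 1 _

theorem dunklProd_cons (p a : Fin n) (l : List (Fin n)) :
    dunklProd p (a :: l) = (1 + bracket a p) * dunklProd p l := by
  rw [dunklProd, List.map_cons, List.prod_cons, ← dunklProd]

theorem dunklProd_append (p : Fin n) (l l' : List (Fin n)) :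
    dunklProd p (l ++ l') = dunklProd p l * dunklProd p l' := by
  rw [dunklProd, List.map_append, List.prod_append, ← dunklProd, ← dunklProd]

theorem exists_one_sub_kappa_of_covBy {i j : Fin n} (hij : i ⋖ j) :
    ∃ m : List (Fin n), (∀ a ∈ m, a ≠ i ∧ a ≠ j) ∧
      1 - kappa i = dunklProd i m * (1 + bracket j i) ∧
      1 - kappa j = (1 + bracket i j) * dunklProd j m := by
  obtain ⟨m, hi, hj⟩ := exists_dunklOrder_of_covBy hij
  refine ⟨m, fun a ha => ⟨ne_of_mem_dunklOrder (hi ▸ List.mem_append_left _ ha),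
    ne_of_mem_dunklOrder (hj ▸ List.mem_cons_of_mem _ ha)⟩, ?_, ?_⟩
  · have hnil : dunklProd i [] = 1 := List.prod_nil
    rw [one_sub_kappa, hi, dunklProd_append, dunklProd_cons, hnil, mul_one]
  · rw [one_sub_kappa, hj, dunklProd_cons]

theorem exists_one_sub_kappa_of_ne {i j p : Fin n} (hij : i ⋖ j) (hi : p ≠ i) (hj : p ≠ j) :
    ∃ m m' : List (Fin n), (∀ a ∈ m, a ≠ i ∧ a ≠ j) ∧ (∀ a ∈ m', a ≠ i ∧ a ≠ j) ∧
      1 - kappa p =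
        dunklProd p m * ((1 + bracket j p) * (1 + bracket i p)) * dunklProd p m' := by
  obtain ⟨m, m', h⟩ := exists_dunklOrder_of_ne hij hi hj
  have hnd := nodup_dunklOrder p
  rw [h, List.nodup_append, List.nodup_cons, List.nodup_cons] at hnd
  obtain ⟨-, ⟨hjm', him', -⟩, hm⟩ := hnd
  refine ⟨m, m', fun a ha => ⟨hm a ha i (by simp), hm a ha j (by simp)⟩,
    fun a ha => ⟨?_, ?_⟩, ?_⟩
  · rintro rfl
    exact him' ha
  · rintro rfl
    exact hjm' (List.mem_cons_of_mem _ ha)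
  · rw [one_sub_kappa, h, dunklProd_append, dunklProd_cons, dunklProd_cons]
    simp only [mul_assoc]

end QuadAlg

/-! ### Descent elements -/

section DescentElement

theorem list_prod_mul_comm {M α : Type*} [Monoid M] {x : M} {f g : α → M} {l : List α}
    (h : ∀ a ∈ l, f a * x = x * g a) : (l.map f).prod * x = x * (l.map g).prod := by
  induction l with
  | nil => rw [List.map_nil, List.map_nil, List.prod_nil, one_mul, mul_one]
  | cons a l ih =>
    rw [List.forall_mem_cons] at h
    rw [List.map_cons, List.map_cons, List.prod_cons, List.prod_cons, mul_assoc, ih h.2,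
      ← mul_assoc, h.1, mul_assoc]

variable {n : ℕ} {R : Type*} [Semiring R] [Algebra ℤ R]
  {ρ : QuadAlg n →ₐ[ℤ] R} {i j : Fin n} {d : R}

/-- An abstraction of the operator `d` on `ℤ⟨S_n⟩` that sends `w` to `w t_{ij}` if
`w(i) > w(j)` and to `0` otherwise, for neighbouring positions `i < j`. For this operator,
`(1 + [ij]) d` is a Demazure operator: it removes the descent of `w` at `i, j`, if there is one,
and fixes `w` otherwise. -/
structure IsDescentElement (ρ : QuadAlg n →ₐ[ℤ] R) (i j : Fin n) (d : R) : Prop where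
  one_add_bracket_mul : ∀ a b, s(a, b) ≠ s(i, j) →
    ρ (1 + bracket a b) * d = d * ρ (1 + bracket (Equiv.swap i j a) (Equiv.swap i j b))
  one_add_bracket_mul_self : ρ (1 + bracket i j) * d = 1 + d * ρ (1 + bracket j i)

namespace IsDescentElement

theorem map_dunklProd_mul (hd : IsDescentElement ρ i j d) {m : List (Fin n)}
    (hm : ∀ a ∈ m, a ≠ i ∧ a ≠ j) (p : Fin n) :
    ρ (dunklProd p m) * d = d * ρ (dunklProd (Equiv.swap i j p) m) := by
  simp only [dunklProd, map_list_prod, List.map_map]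
  refine list_prod_mul_comm fun a ha => ?_
  obtain ⟨hi, hj⟩ := hm a ha
  have hmul := hd.one_add_bracket_mul a p (by simp [hi, hj])
  rwa [Equiv.swap_apply_of_ne_of_ne hi hj] at hmul

variable (hd : IsDescentElement ρ i j d)
include hd

theorem map_one_sub_kappa_left_mul (hij : i ⋖ j) :
    ρ (1 - kappa i) * (ρ (1 + bracket i j) * d) + ρ (1 - kappa j) =
      ρ (1 + bracket i j) * d * ρ (1 - kappa j) := by
  obtain ⟨m, hm, hi, hj⟩ := exists_one_sub_kappa_of_covBy hij
  have hcomm := hd.map_dunklProd_mul hm i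
  rw [Equiv.swap_apply_left] at hcomm
  have hinv : ρ (1 + bracket j i) * ρ (1 + bracket i j) = 1 := by
    rw [← map_mul, one_add_bracket_mul_symm, map_one]
  calc ρ (1 - kappa i) * (ρ (1 + bracket i j) * d) + ρ (1 - kappa j)
      = ρ (dunklProd i m) * (ρ (1 + bracket j i) * ρ (1 + bracket i j)) * d + ρ (1 - kappa j) := by
        rw [hi, map_mul]
        simp only [mul_assoc]
    _ = d * (ρ (1 + bracket j i) * ρ (1 + bracket i j)) * ρ (dunklProd j m)
          + ρ (1 - kappa j) := by
        rw [hinv, mul_one, mul_one, hcomm]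
    _ = (1 + d * ρ (1 + bracket j i)) * ρ (1 - kappa j) := by
        rw [hj, map_mul]
        noncomm_ring
    _ = ρ (1 + bracket i j) * d * ρ (1 - kappa j) := by rw [hd.one_add_bracket_mul_self]

theorem map_one_sub_kappa_right_mul (hij : i ⋖ j) :
    ρ (1 - kappa j) * (ρ (1 + bracket i j) * d) =
      ρ (1 - kappa j) + ρ (1 + bracket i j) * d * ρ (1 - kappa i) := by
  obtain ⟨m, hm, hi, hj⟩ := exists_one_sub_kappa_of_covBy hij
  have hcomm := hd.map_dunklProd_mul hm j
  rw [Equiv.swap_apply_right] at hcomm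
  calc ρ (1 - kappa j) * (ρ (1 + bracket i j) * d)
      = ρ (1 - kappa j) + ρ (1 + bracket i j) * (ρ (dunklProd j m) * d) * ρ (1 + bracket j i) := by
        rw [hd.one_add_bracket_mul_self, hj, map_mul]
        noncomm_ring
    _ = ρ (1 - kappa j) + ρ (1 + bracket i j) * d * ρ (1 - kappa i) := by
        rw [hcomm, hi, map_mul]
        simp only [mul_assoc]

theorem commute_map_dunklProd {m : List (Fin n)} (hm : ∀ a ∈ m, a ≠ i ∧ a ≠ j) {p : Fin n}
    (hi : p ≠ i) (hj : p ≠ j) : Commute (ρ (dunklProd p m)) (ρ (1 + bracket i j) * d) := by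
  refine Commute.mul_right (Commute.map ?_ ρ) ?_
  · refine Commute.list_prod_left _ _ fun x hx => ?_
    obtain ⟨a, ha, rfl⟩ := List.mem_map.mp hx
    have hcomm := bracket_commute (hm a ha).1 (hm a ha).2 hi hj
    exact ((Commute.one_left _).add_left ((Commute.one_right _).add_right hcomm))
  · have hmul := hd.map_dunklProd_mul hm p
    rwa [Equiv.swap_apply_of_ne_of_ne hi hj] at hmul

theorem commute_map_one_add_bracket_mul {p : Fin n} (hi : p ≠ i) (hj : p ≠ j) :
    Commute (ρ ((1 + bracket j p) * (1 + bracket i p))) (ρ (1 + bracket i j) * d) := by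
  have hdi := hd.one_add_bracket_mul i p (by simp [hi, hj])
  have hdj := hd.one_add_bracket_mul j p (by simp [hi, hj])
  rw [Equiv.swap_apply_of_ne_of_ne hi hj, Equiv.swap_apply_left] at hdi
  rw [Equiv.swap_apply_of_ne_of_ne hi hj, Equiv.swap_apply_right] at hdj
  calc ρ ((1 + bracket j p) * (1 + bracket i p)) * (ρ (1 + bracket i j) * d)
      = ρ ((1 + bracket j p) * (1 + bracket i p) * (1 + bracket i j)) * d := by
        rw [← mul_assoc, ← map_mul]
    _ = ρ (1 + bracket i j) * (ρ (1 + bracket i p) * (ρ (1 + bracket j p) * d)) := by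
        rw [bracket_yangBaxter, map_mul, map_mul]
        simp only [mul_assoc]
    _ = ρ (1 + bracket i j) * d * ρ ((1 + bracket j p) * (1 + bracket i p)) := by
        rw [hdj, ← mul_assoc _ d, hdi, map_mul]
        simp only [mul_assoc]

theorem commute_map_one_sub_kappa (hij : i ⋖ j) {p : Fin n} (hi : p ≠ i) (hj : p ≠ j) :
    Commute (ρ (1 - kappa p)) (ρ (1 + bracket i j) * d) := by
  obtain ⟨m, m', hm, hm', hp⟩ := exists_one_sub_kappa_of_ne hij hi hj
  rw [hp, map_mul, map_mul]
  exact ((hd.commute_map_dunklProd hm hi hj).mul_left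
    (hd.commute_map_one_add_bracket_mul hi hj)).mul_left (hd.commute_map_dunklProd hm' hi hj)

end IsDescentElement

end DescentElement

/-! ### The Bruhat representation -/

section Bruhat

open MulOpposite

variable {n : ℕ} {i j : Fin n}

theorem zs_hom_ext {f g : ZS n →ₗ[ℤ] ZS n}
    (h : ∀ w, f (Finsupp.single w 1) = g (Finsupp.single w 1)) : f = g :=
  Finsupp.lhom_ext' fun w => LinearMap.ext_ring (h w)

theorem bruhat_bracket {a b : Fin n} (h : a ≠ b) :
    bruhat n (bracket a b) = op (bruhatOp a b) := by
  rw [bracket_of_ne h, bruhat, RingQuot.liftAlgHom_mkAlgHom_apply, freeGen,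
    FreeAlgebra.lift_ι_apply]

theorem le_or_le_of_covBy (hij : i ⋖ j) (m : Fin n) : m ≤ i ∨ j ≤ m :=
  (le_or_gt m i).imp_right hij.ge_of_gt

theorem swap_apply_lt_swap_apply (hij : i ⋖ j) {a b : Fin n} (hab : a < b)
    (hne : s(a, b) ≠ s(i, j)) : Equiv.swap i j a < Equiv.swap i j b := by
  have hlt := hij.lt
  have ha := le_or_le_of_covBy hij a
  have hb := le_or_le_of_covBy hij b
  simp only [ne_eq, Sym2.eq_iff, not_or] at hne
  simp only [Equiv.swap_apply_def]
  grind

theorem cov_iff_lt_of_covBy (hij : i ⋖ j) (w : Equiv.Perm (Fin n)) : Cov w i j ↔ w i < w j :=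
  and_iff_left fun _ him hmj => absurd hmj (hij.2 him)

theorem length_mul_swap_of_covBy (hij : i ⋖ j) {w : Equiv.Perm (Fin n)} (h : w j < w i) :
    length (w * Equiv.swap i j) + 1 = length w := by
  have hcov := (cov_iff_lt_of_covBy hij (w * Equiv.swap i j)).mpr (by simpa using h)
  have hlen := (length_swap_iff _ hij.lt).mpr hcov
  rwa [Equiv.mul_swap_mul_self, eq_comm] at hlen

theorem lt_of_cov_of_mul_swap_lt (hij : i ⋖ j) {w : Equiv.Perm (Fin n)} {a b : Fin n}
    (hab : a < b) (hne : s(a, b) ≠ s(i, j)) (hcov : Cov w a b)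
    (h : (w * Equiv.swap a b) j < (w * Equiv.swap a b) i) : w j < w i := by
  have hlt := hij.lt
  have ha := le_or_le_of_covBy hij a
  have hb := le_or_le_of_covBy hij b
  obtain ⟨hwa, hwb, hw⟩ := swap_vals w a b
  simp only [ne_eq, Sym2.eq_iff, not_or] at hne
  obtain ⟨hlt_ab, hbetween⟩ := hcov
  generalize w * Equiv.swap a b = w' at *
  have := w.injective.ne hlt.ne
  grind

theorem mul_swap_mul_swap (w : Equiv.Perm (Fin n)) (i j a b : Fin n) :
    w * Equiv.swap i j * Equiv.swap (Equiv.swap i j a) (Equiv.swap i j b) =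
      w * Equiv.swap a b * Equiv.swap i j := by
  rw [mul_assoc, Equiv.mul_swap_eq_swap_mul, Equiv.swap_apply_self, Equiv.swap_apply_self,
    mul_assoc]

theorem cov_and_mul_swap_lt_iff (hij : i ⋖ j) (w : Equiv.Perm (Fin n)) {a b : Fin n}
    (hab : a < b) (hne : s(a, b) ≠ s(i, j)) :
    Cov w a b ∧ (w * Equiv.swap a b) j < (w * Equiv.swap a b) i ↔
      w j < w i ∧ Cov (w * Equiv.swap i j) (Equiv.swap i j a) (Equiv.swap i j b) := by
  have hab' := swap_apply_lt_swap_apply hij hab hne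
  have hne' : s(Equiv.swap i j a, Equiv.swap i j b) ≠ s(i, j) := by
    simp only [ne_eq, Sym2.eq_iff, Equiv.swap_apply_eq_iff, Equiv.swap_apply_left,
      Equiv.swap_apply_right] at hne ⊢
    rwa [or_comm]
  have hlen := congrArg length (mul_swap_mul_swap w i j a b)
  rw [← length_swap_iff w hab, ← length_swap_iff _ hab']
  constructor
  · rintro ⟨hcov, hlt⟩
    have hw := lt_of_cov_of_mul_swap_lt hij hab hne ((length_swap_iff w hab).mp hcov) hlt
    have hlen₁ := length_mul_swap_of_covBy hij hw
    have hlen₂ := length_mul_swap_of_covBy hij hlt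
    exact ⟨hw, by omega⟩
  · rintro ⟨hw, hcov⟩
    have hlt : (w * Equiv.swap a b) j < (w * Equiv.swap a b) i := by
      by_contra hge
      have hwt : (w * Equiv.swap a b) i < (w * Equiv.swap a b) j :=
        (not_lt.mp hge).lt_of_ne ((w * Equiv.swap a b).injective.ne hij.lt.ne)
      have hws := lt_of_cov_of_mul_swap_lt hij hab' hne' ((length_swap_iff _ hab').mp hcov)
        (by rw [mul_swap_mul_swap]; simpa using hwt)
      exact hw.asymm (by simpa using hws)
    have hlen₁ := length_mul_swap_of_covBy hij hw
    have hlen₂ := length_mul_swap_of_covBy hij hlt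
    exact ⟨by omega, hlt⟩

/-- The operator on `ℤ⟨S_n⟩` that sends `w` to `w t_{ij}` if `w(i) > w(j)`, and to `0`
otherwise. -/
noncomputable def descentOp (i j : Fin n) : ZS n →ₗ[ℤ] ZS n :=
  Finsupp.linearCombination ℤ fun w =>
    (if w j < w i then (1 : ℤ) else 0) • Finsupp.single (w * Equiv.swap i j) (1 : ℤ)

theorem descentOp_single (i j : Fin n) (w : Equiv.Perm (Fin n)) :
    descentOp i j (Finsupp.single w 1) =
      (if w j < w i then (1 : ℤ) else 0) • Finsupp.single (w * Equiv.swap i j) 1 := by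
  rw [descentOp, Finsupp.linearCombination_single, one_smul]

theorem sgnCov_mul_descent (hij : i ⋖ j) (w : Equiv.Perm (Fin n)) {a b : Fin n} (hab : a ≠ b)
    (hne : s(a, b) ≠ s(i, j)) :
    sgnCov w a b * (if (w * Equiv.swap a b) j < (w * Equiv.swap a b) i then 1 else 0) =
      (if w j < w i then 1 else 0) *
        sgnCov (w * Equiv.swap i j) (Equiv.swap i j a) (Equiv.swap i j b) := by
  wlog h : a < b generalizing a b with hwlog
  · have hba := hwlog hab.symm (by rwa [Sym2.eq_swap]) (hab.symm.lt_of_le (not_lt.mp h))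
    rw [sgnCov_antisymm w a b hab, sgnCov_antisymm _ (Equiv.swap i j a) _
      ((Equiv.swap i j).injective.ne hab), Equiv.swap_comm a b, neg_mul, mul_neg, hba]
  rw [sgnCov, sgnCov, if_pos h, if_pos (swap_apply_lt_swap_apply hij h hne)]
  simp only [ite_zero_mul_ite_zero, mul_one]
  congr 1
  exact propext (cov_and_mul_swap_lt_iff hij w h hne)

theorem descentOp_comp_bruhatOp (hij : i ⋖ j) {a b : Fin n} (hab : a ≠ b)
    (hne : s(a, b) ≠ s(i, j)) :
    descentOp i j ∘ₗ bruhatOp a b =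
      bruhatOp (Equiv.swap i j a) (Equiv.swap i j b) ∘ₗ descentOp i j := by
  refine zs_hom_ext fun w => ?_
  rw [LinearMap.comp_apply, LinearMap.comp_apply, bruhatOp_single w a b hab, map_smul,
    descentOp_single, smul_smul, descentOp_single, map_smul,
    bruhatOp_single _ _ _ ((Equiv.swap i j).injective.ne hab), smul_smul, mul_swap_mul_swap,
    sgnCov_mul_descent hij w hab hne]

theorem bruhatOp_single_of_covBy (hij : i ⋖ j) (w : Equiv.Perm (Fin n)) :
    bruhatOp i j (Finsupp.single w 1) =
      (if w i < w j then (1 : ℤ) else 0) • Finsupp.single (w * Equiv.swap i j) 1 := by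
  rw [bruhatOp_single w i j hij.lt.ne, sgnCov, if_pos hij.lt]
  simp only [cov_iff_lt_of_covBy hij]

/-- The Demazure action of `t_{ij}` on `S_n` from the right, for neighbouring positions `i < j`. -/
noncomputable abbrev finDemazure (i j : Fin n) : Equiv.Perm (Fin n) → Equiv.Perm (Fin n) :=
  removeDescent (· * Equiv.swap i j) fun w => w j < w i

theorem descentOp_comp_one_add_bruhatOp (hij : i ⋖ j) :
    descentOp i j ∘ₗ (1 + bruhatOp i j) = Finsupp.lmapDomain ℤ ℤ (finDemazure i j) := by
  refine zs_hom_ext fun w => ?_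
  rw [LinearMap.comp_apply, LinearMap.add_apply, map_add, bruhatOp_single_of_covBy hij,
    map_smul, Module.End.one_apply, Finsupp.lmapDomain_apply, Finsupp.mapDomain_single,
    finDemazure, removeDescent, descentOp_single, descentOp_single]
  rcases lt_or_gt_of_ne (w.injective.ne hij.lt.ne) with h | h
  · simp [h, h.asymm, mul_assoc]
  · simp [h, h.asymm]

theorem one_add_bruhatOp_symm_comp_descentOp (hij : i ⋖ j) :
    1 + (1 + bruhatOp j i) ∘ₗ descentOp i j = Finsupp.lmapDomain ℤ ℤ (finDemazure i j) := by
  refine zs_hom_ext fun w => ?_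
  rw [← neg_eq_of_add_eq_zero_right (bruhat_antisymm i j hij.lt.ne), LinearMap.add_apply,
    LinearMap.comp_apply, Module.End.one_apply, Finsupp.lmapDomain_apply,
    Finsupp.mapDomain_single, finDemazure, removeDescent, descentOp_single, map_smul,
    LinearMap.add_apply, LinearMap.neg_apply, bruhatOp_single_of_covBy hij, Module.End.one_apply]
  rcases lt_or_gt_of_ne (w.injective.ne hij.lt.ne) with h | h
  · simp [h.asymm]
  · simp [h, mul_assoc]

theorem map_one_add_bracket_mul_op_descentOp (hij : i ⋖ j) :
    bruhat n (1 + bracket i j) * op (descentOp i j) =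
      op (Finsupp.lmapDomain ℤ ℤ (finDemazure i j)) := by
  rw [map_add, map_one, bruhat_bracket hij.lt.ne, ← descentOp_comp_one_add_bruhatOp hij]
  rfl

theorem isDescentElement_descentOp (hij : i ⋖ j) :
    IsDescentElement (bruhat n) i j (op (descentOp i j)) where
  one_add_bracket_mul a b hne := by
    rw [map_add, map_add, map_one, add_mul, mul_add, one_mul, mul_one]
    rcases eq_or_ne a b with rfl | hab
    · rw [bracket_self, bracket_self, map_zero, zero_mul, mul_zero]
    · rw [bruhat_bracket hab, bruhat_bracket ((Equiv.swap i j).injective.ne hab), ← op_mul,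
        ← op_mul, Module.End.mul_eq_comp, Module.End.mul_eq_comp,
        descentOp_comp_bruhatOp hij hab hne]
  one_add_bracket_mul_self := by
    rw [map_one_add_bracket_mul_op_descentOp hij, ← one_add_bruhatOp_symm_comp_descentOp hij,
      map_add, map_one, bruhat_bracket hij.lt.ne']
    rfl

end Bruhat

/-! ### The part of an expansion inside `S_n` -/

section Expansion

variable {n : ℕ} {i j : Fin n}

theorem toSInf_apply (w : Equiv.Perm (Fin n)) (a : Fin n) : (toSInf w).1 a.val = (w a).val :=
  Equiv.Perm.extendDomain_apply_image w Fin.equivSubtype a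

theorem toSInf_fixed (w : Equiv.Perm (Fin n)) (i : ℕ) (hi : n ≤ i) : (toSInf w).1 i = i :=
  Equiv.Perm.extendDomain_apply_not_subtype _ _ (not_lt.mpr hi)

theorem toSInf_injective : Function.Injective (toSInf (n := n)) := fun v w h =>
  Equiv.ext fun a => Fin.ext <| by rw [← toSInf_apply, ← toSInf_apply, h]

theorem toSInf_one : toSInf (1 : Equiv.Perm (Fin n)) = oneSInf := by
  refine Subtype.ext (Equiv.ext fun k => ?_)
  by_cases hk : k < n
  · exact toSInf_apply 1 ⟨k, hk⟩
  · exact toSInf_fixed 1 k (not_lt.mp hk)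

theorem val_add_one_of_covBy (hij : i ⋖ j) : i.val + 1 = j.val :=
  Order.covBy_iff_add_one_eq.mp (Fin.covBy_iff.mp hij)

theorem toSInf_mul_swap (hij : i ⋖ j) (w : Equiv.Perm (Fin n)) :
    toSInf (w * Equiv.swap i j) = mulSwap i (toSInf w) := by
  refine Subtype.ext (Equiv.ext fun k => ?_)
  rw [mulSwap, Equiv.Perm.mul_apply, val_add_one_of_covBy hij]
  by_cases hk : k < n
  · lift k to Fin n using hk
    rw [← Fin.val_injective.map_swap, toSInf_apply, toSInf_apply, Equiv.Perm.mul_apply]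
  · rw [toSInf_fixed _ k (not_lt.mp hk), Equiv.swap_apply_of_ne_of_ne (by omega) (by omega),
      toSInf_fixed _ k (not_lt.mp hk)]

theorem toSInf_lt_iff (hij : i ⋖ j) (w : Equiv.Perm (Fin n)) :
    (toSInf w).1 (i.val + 1) < (toSInf w).1 i.val ↔ w j < w i := by
  rw [val_add_one_of_covBy hij, toSInf_apply, toSInf_apply, Fin.lt_def]

theorem semiconj_toSInf_finDemazure (hij : i ⋖ j) :
    Function.Semiconj toSInf (finDemazure i j) (demazure i) := fun w => by
  rw [finDemazure, demazure, removeDescent, removeDescent, apply_ite toSInf, toSInf_mul_swap hij]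
  congr 1
  exact propext (toSInf_lt_iff hij w).symm

theorem mem_range_toSInf_of_demazure (hij : i ⋖ j) {v : SInf}
    (h : demazure i v ∈ Set.range (toSInf (n := n))) : v ∈ Set.range (toSInf (n := n)) := by
  obtain ⟨w, hw⟩ := h
  rw [demazure, removeDescent] at hw
  split_ifs at hw
  · exact ⟨w * Equiv.swap i j, by rw [toSInf_mul_swap hij, hw, mulSwap_mulSwap]⟩
  · exact ⟨w, hw⟩

theorem perm_induction {P : Equiv.Perm (Fin n) → Prop} (one : P 1)
    (step : ∀ w (i j : Fin n), i ⋖ j → w j < w i → P (w * Equiv.swap i j) → P w)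
    (w : Equiv.Perm (Fin n)) : P w := by
  suffices h : ∀ v : SInf, ∀ w : Equiv.Perm (Fin n), toSInf w = v → P w from h _ w rfl
  refine sInf_induction (fun w hw => ?_) fun v i hi ih w hw => ?_
  · rw [← toSInf_one (n := n)] at hw
    exact toSInf_injective hw ▸ one
  · subst hw
    have hin : i + 1 < n := by
      by_contra! hn
      have hlt := apply_lt_of_fixed (fun k hk => toSInf_fixed w k (hn.trans hk)) i.lt_succ_self
      rw [toSInf_fixed w _ hn] at hi
      omega
    have hij : (⟨i, by omega⟩ : Fin n) ⋖ ⟨i + 1, hin⟩ :=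
      Fin.covBy_iff.mpr (Order.covBy_add_one i)
    exact step w _ _ hij ((toSInf_lt_iff hij w).mp hi) (ih _ (toSInf_mul_swap hij w))

theorem comapDomain_mapDomain_of_semiconj {α β M : Type*} [AddCommMonoid M] {φ : α → β}
    (hφ : Function.Injective φ) {d : α → α} {d' : β → β} (hd : Function.Semiconj φ d d')
    (hrange : ∀ b, d' b ∈ Set.range φ → b ∈ Set.range φ) (c : β →₀ M) :
    (c.mapDomain d').comapDomain φ hφ.injOn = (c.comapDomain φ hφ.injOn).mapDomain d := by
  induction c using Finsupp.induction_linear with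
  | zero => rw [Finsupp.mapDomain_zero, Finsupp.comapDomain_zero, Finsupp.mapDomain_zero]
  | add f g hf hg =>
    rw [Finsupp.mapDomain_add, Finsupp.comapDomain_add_of_injective hφ, hf, hg,
      Finsupp.comapDomain_add_of_injective hφ, Finsupp.mapDomain_add]
  | single b m =>
    rw [Finsupp.mapDomain_single]
    by_cases hb : b ∈ Set.range φ
    · obtain ⟨a, rfl⟩ := hb
      simp only [← hd.eq, Finsupp.comapDomain_single, Finsupp.mapDomain_single]
    · rw [Finsupp.comapDomain_single_of_not_mem_range (mt (hrange b) hb),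
        Finsupp.comapDomain_single_of_not_mem_range hb, Finsupp.mapDomain_zero]

/-- The part in `ℤ⟨S_n⟩` of the expansion of a polynomial into Grothendieck polynomials. -/
noncomputable def expansion (n : ℕ) : MvPolynomial ℕ ℤ →ₗ[ℤ] ZS n :=
  Finsupp.lcomapDomain toSInf toSInf_injective ∘ₗ grothendieckBasis.repr.toLinearMap

theorem expansion_apply (f : MvPolynomial ℕ ℤ) (w : Equiv.Perm (Fin n)) :
    expansion n f w = grothendieckBasis.repr f (toSInf w) := rfl

theorem expansion_grothendieck (w : Equiv.Perm (Fin n)) :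
    expansion n (grothendieck (toSInf w)) = Finsupp.single w 1 := by
  ext v
  classical
  rw [expansion_apply, grothendieckBasis_repr_grothendieck, Finsupp.single_apply,
    Finsupp.single_apply]
  simp only [toSInf_injective.eq_iff]

theorem expansion_apply_one (f : MvPolynomial ℕ ℤ) : expansion n f 1 = constantCoeff f := by
  rw [expansion_apply, toSInf_one, grothendieckBasis_repr_one]

theorem expansion_isobaric (hij : i ⋖ j) (f : MvPolynomial ℕ ℤ) :
    expansion n (isobaric i f) = Finsupp.mapDomain (finDemazure i j) (expansion n f) := by
  rw [expansion, LinearMap.comp_apply, LinearEquiv.coe_coe, grothendieckBasis_repr_isobaric]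
  exact comapDomain_mapDomain_of_semiconj toSInf_injective (semiconj_toSInf_finDemazure hij)
    (fun _ => mem_range_toSInf_of_demazure hij) _

end Expansion

/-! ### Multiplication by a variable -/

section Monk

open MulOpposite

variable {n : ℕ} {i j : Fin n}

theorem sgnCov_swap (a b : Fin n) : sgnCov (Equiv.swap a b) a b = 0 := by
  simp only [sgnCov, Cov, Equiv.swap_apply_left, Equiv.swap_apply_right]
  grind

theorem bruhatOp_apply_one {a b : Fin n} (hab : a ≠ b) (c : ZS n) : bruhatOp a b c 1 = 0 := by
  suffices h : Finsupp.lapply 1 ∘ₗ bruhatOp a b = 0 from LinearMap.congr_fun h c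
  refine Finsupp.lhom_ext' fun w => LinearMap.ext_ring ?_
  rw [LinearMap.comp_apply, LinearMap.comp_apply, Finsupp.lsingle_apply, bruhatOp_single w a b hab,
    map_smul, Finsupp.lapply_apply]
  by_cases hw : w * Equiv.swap a b = 1
  · obtain rfl : w = Equiv.swap a b := by rwa [mul_eq_one_iff_eq_inv, Equiv.swap_inv] at hw
    rw [sgnCov_swap, zero_smul]
    rfl
  · rw [Finsupp.single_eq_of_ne' hw, smul_zero]
    rfl

theorem bruhat_dunklProd_apply_one {p : Fin n} {l : List (Fin n)} (hl : ∀ a ∈ l, a ≠ p)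
    (c : ZS n) : (bruhat n (dunklProd p l)).unop c 1 = c 1 := by
  induction l generalizing c with
  | nil =>
    rw [dunklProd, List.map_nil, List.prod_nil, map_one (bruhat n)]
    rfl
  | cons a l ih =>
    obtain ⟨hap, hlp⟩ := List.forall_mem_cons.mp hl
    rw [dunklProd_cons, map_mul, unop_mul, Module.End.mul_apply, ih hlp, map_add,
      map_one (bruhat n), bruhat_bracket hap, unop_add, LinearMap.add_apply, Finsupp.add_apply,
      unop_op, bruhatOp_apply_one hap, add_zero]
    rfl

/-- The defect of `1 - κ_p` acting as multiplication by `1 - x_p`. -/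
noncomputable def dunklDefect (p : Fin n) : MvPolynomial ℕ ℤ →ₗ[ℤ] ZS n :=
  expansion n ∘ₗ LinearMap.mulLeft ℤ (1 - X p.val) - (bruhat n (1 - kappa p)).unop ∘ₗ expansion n

theorem dunklDefect_apply (p : Fin n) (f : MvPolynomial ℕ ℤ) :
    dunklDefect p f =
      expansion n ((1 - X p.val) * f) - (bruhat n (1 - kappa p)).unop (expansion n f) := rfl

theorem dunklDefect_apply_one (p : Fin n) (f : MvPolynomial ℕ ℤ) : dunklDefect p f 1 = 0 := by
  rw [dunklDefect_apply, Finsupp.sub_apply, one_sub_kappa,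
    bruhat_dunklProd_apply_one fun _ => ne_of_mem_dunklOrder, expansion_apply_one,
    expansion_apply_one, map_mul, map_sub, map_one, constantCoeff_X, sub_zero, one_mul, sub_self]

theorem unop_mul_descentOp_expansion (hij : i ⋖ j) (f : MvPolynomial ℕ ℤ) :
    (bruhat n (1 + bracket i j) * op (descentOp i j)).unop (expansion n f) =
      expansion n (isobaric i f) := by
  rw [map_one_add_bracket_mul_op_descentOp hij, expansion_isobaric hij]
  rfl

theorem mapDomain_dunklDefect (hij : i ⋖ j) (p : Fin n) (f : MvPolynomial ℕ ℤ) :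
    Finsupp.mapDomain (finDemazure i j) (dunklDefect p f) =
      expansion n (isobaric i ((1 - X p.val) * f)) -
        (bruhat n (1 - kappa p) * (bruhat n (1 + bracket i j) * op (descentOp i j))).unop
          (expansion n f) := by
  rw [expansion_isobaric hij, map_one_add_bracket_mul_op_descentOp hij, dunklDefect_apply,
    ← Finsupp.lmapDomain_apply ℤ ℤ, map_sub]
  rfl

theorem mapDomain_dunklDefect_left (hij : i ⋖ j) (f : MvPolynomial ℕ ℤ) :
    Finsupp.mapDomain (finDemazure i j) (dunklDefect i f) = dunklDefect j (isobaric i f - f) := by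
  have h := (isDescentElement_descentOp hij).map_one_sub_kappa_left_mul hij
  rw [mapDomain_dunklDefect hij, isobaric_mul_left, val_add_one_of_covBy hij,
    eq_sub_of_add_eq h, unop_sub, unop_mul, LinearMap.sub_apply, Module.End.mul_apply,
    unop_mul_descentOp_expansion hij, ← map_sub, ← map_sub, dunklDefect_apply]

theorem mapDomain_dunklDefect_right (hij : i ⋖ j) (f : MvPolynomial ℕ ℤ) :
    Finsupp.mapDomain (finDemazure i j) (dunklDefect j f) =
      dunklDefect j f + dunklDefect i (isobaric i f) := by
  have h := (isDescentElement_descentOp hij).map_one_sub_kappa_right_mul hij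
  rw [mapDomain_dunklDefect hij, ← val_add_one_of_covBy hij, isobaric_mul_right,
    val_add_one_of_covBy hij, h, unop_add, unop_mul, LinearMap.add_apply, Module.End.mul_apply,
    unop_mul_descentOp_expansion hij, map_add, add_sub_add_comm, dunklDefect_apply,
    dunklDefect_apply]

theorem mapDomain_dunklDefect_of_ne (hij : i ⋖ j) {p : Fin n} (hi : p ≠ i) (hj : p ≠ j)
    (f : MvPolynomial ℕ ℤ) :
    Finsupp.mapDomain (finDemazure i j) (dunklDefect p f) = dunklDefect p (isobaric i f) := by
  have h := ((isDescentElement_descentOp hij).commute_map_one_sub_kappa hij hi hj).eq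
  have hX : swapVars i (1 - X p.val) = 1 - X p.val :=
    swapVars_one_sub_X_of_ne (Fin.val_ne_of_ne hi)
      (val_add_one_of_covBy hij ▸ Fin.val_ne_of_ne hj)
  rw [mapDomain_dunklDefect hij, isobaric_mul_of_swapVars_eq hX, h, unop_mul,
    Module.End.mul_apply, unop_mul_descentOp_expansion hij, dunklDefect_apply]

/-- The subgroup of `ℤ⟨S_n⟩` generated by all defects; it is stable under the Demazure operators. -/
noncomputable def defectSpan (n : ℕ) : Submodule ℤ (ZS n) :=
  ⨆ p : Fin n, LinearMap.range (dunklDefect p)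

theorem dunklDefect_mem_defectSpan (p : Fin n) (f : MvPolynomial ℕ ℤ) :
    dunklDefect p f ∈ defectSpan n :=
  Submodule.mem_iSup_of_mem p (LinearMap.mem_range_self _ f)

theorem defectSpan_le_comap (hij : i ⋖ j) :
    defectSpan n ≤ (defectSpan n).comap (Finsupp.lmapDomain ℤ ℤ (finDemazure i j)) := by
  refine iSup_le fun p => ?_
  rintro _ ⟨f, rfl⟩
  rw [Submodule.mem_comap, Finsupp.lmapDomain_apply]
  rcases eq_or_ne p i with rfl | hi
  · rw [mapDomain_dunklDefect_left hij]
    exact dunklDefect_mem_defectSpan _ _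
  rcases eq_or_ne p j with rfl | hj
  · rw [mapDomain_dunklDefect_right hij]
    exact add_mem (dunklDefect_mem_defectSpan _ _) (dunklDefect_mem_defectSpan _ _)
  · rw [mapDomain_dunklDefect_of_ne hij hi hj]
    exact dunklDefect_mem_defectSpan _ _

theorem defectSpan_le_ker :
    defectSpan n ≤ LinearMap.ker (Finsupp.lapply (1 : Equiv.Perm (Fin n))) := by
  refine iSup_le fun p => ?_
  rintro _ ⟨f, rfl⟩
  exact dunklDefect_apply_one p f

theorem dunklDefect_eq_zero (p : Fin n) (f : MvPolynomial ℕ ℤ) : dunklDefect p f = 0 := by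
  refine eq_zero_of_stable (ι := {q : Fin n × Fin n // q.1 ⋖ q.2}) (e := 1)
    (σ := fun q w => w * Equiv.swap q.1.1 q.1.2) (D := fun q w => w q.1.2 < w q.1.1)
    (fun q w => Equiv.mul_swap_mul_self q.1.1 q.1.2 w) (fun q w => ?_)
    (fun P one step => perm_induction one fun w i j hij => step w ⟨(i, j), hij⟩)
    (fun q c hc => defectSpan_le_comap q.2 hc) (fun c hc => defectSpan_le_ker hc)
    (dunklDefect_mem_defectSpan p f)
  rw [Equiv.Perm.mul_apply, Equiv.Perm.mul_apply, Equiv.swap_apply_right,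
    Equiv.swap_apply_left, not_lt, (w.injective.ne q.2.lt.ne).le_iff_lt]

/-- The `K`-theoretic Monk formula. -/
theorem expansion_X_mul (p : Fin n) (f : MvPolynomial ℕ ℤ) :
    expansion n (X p.val * f) = (bruhat n (kappa p)).unop (expansion n f) := by
  have h := dunklDefect_eq_zero p f
  rw [dunklDefect_apply, map_sub, map_one, unop_sub, unop_one, LinearMap.sub_apply,
    Module.End.one_apply, sub_mul, one_mul, map_sub, sub_sub_sub_cancel_left, sub_eq_zero] at h
  exact h.symm

end Monk

/-! ### Evaluation at the Dunkl elements -/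

section Evaluation

open MulOpposite

variable {n : ℕ}

theorem expansion_X_pow_mul (p : Fin n) (k : ℕ) (f : MvPolynomial ℕ ℤ) :
    expansion n (X p.val ^ k * f) = (bruhat n (kappa p ^ k)).unop (expansion n f) := by
  induction k with
  | zero =>
    rw [pow_zero, pow_zero, one_mul, map_one (bruhat n)]
    rfl
  | succ k ih =>
    rw [pow_succ', mul_assoc, expansion_X_mul, ih, pow_succ, map_mul, unop_mul,
      Module.End.mul_apply]

theorem expansion_list_prod_mul {a : ℕ → QuadAlg n} {l : List ℕ}
    (ha : ∀ i ∈ l, ∃ p : Fin n, p.val = i ∧ a i = kappa p) (m : ℕ → ℕ) (f : MvPolynomial ℕ ℤ) :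
    expansion n ((l.map fun i => X i ^ m i).prod * f) =
      (bruhat n (l.map fun i => a i ^ m i).prod).unop (expansion n f) := by
  induction l generalizing f with
  | nil =>
    rw [List.map_nil, List.map_nil, List.prod_nil, List.prod_nil, one_mul, map_one (bruhat n)]
    rfl
  | cons i l ih =>
    obtain ⟨⟨p, rfl, hap⟩, hl⟩ := List.forall_mem_cons.mp ha
    rw [List.map_cons, List.prod_cons, List.map_cons, List.prod_cons, mul_comm (X p.val ^ m p),
      mul_assoc, ih hl, map_mul (bruhat n), unop_mul, Module.End.mul_apply, hap,
      expansion_X_pow_mul]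

theorem monomial_eq_smul_list_prod {R ι : Type*} [CommSemiring R] [LinearOrder ι] (m : ι →₀ ℕ)
    (a : R) :
    monomial m a = a • ((m.support.sort (· ≤ ·)).map fun i => X i ^ m i).prod := by
  rw [monomial_eq, ← smul_eq_C_mul, Finsupp.prod, ← Finset.prod_map_toList]
  congr 1
  exact ((Finset.sort_perm_toList _ _).map _).prod_eq.symm

theorem bruhat_evalKappa {f : MvPolynomial ℕ ℤ} (hf : ∀ i ∈ f.vars, i + 1 < n)
    (g : MvPolynomial ℕ ℤ) :
    (bruhat n (evalKappa n f)).unop (expansion n g) = expansion n (f * g) := by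
  conv_rhs => rw [f.as_sum, Finset.sum_mul, map_sum]
  rw [evalKappa, evalAt, map_sum, Finset.unop_sum, LinearMap.sum_apply]
  refine Finset.sum_congr rfl fun m hm => ?_
  rw [map_smul, unop_smul, LinearMap.smul_apply, ← expansion_list_prod_mul, ← map_smul,
    monomial_eq_smul_list_prod, smul_mul_assoc]
  · intro i hi
    have hin : i + 1 < n :=
      hf i ((mem_vars_iff_mem_support i).mpr ⟨m, hm, (Finset.mem_sort _).mp hi⟩)
    exact ⟨⟨i, by omega⟩, rfl, dif_pos hin⟩

end Evaluation

end KFlag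

open KFlag in
theorem corollary3p1_general {n : ℕ} {f : MvPolynomial ℕ ℤ} (hf : ∀ i ∈ f.vars, i + 1 < n)
    (v : Equiv.Perm (Fin n)) :
    (∃! c : SInf →₀ ℤ, f * grothendieck (toSInf v) = c.sum fun w a => a • grothendieck w) ∧
    ∀ c : SInf →₀ ℤ, f * grothendieck (toSInf v) = c.sum (fun w a => a • grothendieck w) →
      ∀ w : Equiv.Perm (Fin n), c (toSInf w) = bruhatAct (evalKappa n f) v w := by
  simp only [eq_grothendieckBasis_repr_iff]
  refine ⟨existsUnique_eq, ?_⟩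
  rintro _ rfl w
  rw [bruhatAct, ← expansion_grothendieck, bruhat_evalKappa hf, expansion_apply]

theorem corollary3p1 (n : ℕ) (u v : Equiv.Perm (Fin n)) :
    (∃! c : KFlag.SInf →₀ ℤ,
      KFlag.IsStructureConstants (KFlag.toSInf u) (KFlag.toSInf v) c) ∧
    ∀ c : KFlag.SInf →₀ ℤ, KFlag.IsStructureConstants (KFlag.toSInf u) (KFlag.toSInf v) c →
      ∀ w : Equiv.Perm (Fin n), KFlag.length u + KFlag.length v ≤ KFlag.length w →
        c (KFlag.toSInf w) =
          KFlag.bruhatAct (KFlag.evalKappa n (KFlag.grothendieck (KFlag.toSInf u))) v w :=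
  have h := corollary3p1_general
    (fun _ => KFlag.lt_of_mem_vars_grothendieck (KFlag.toSInf_fixed u)) v
  ⟨h.1, fun c hc w _ => h.2 c hc w⟩
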